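/- Let $L>0$, let $\mathcal H$ be a summable function on $[0,L]$ whose values are real nonnegative $2\times2$ matrices of trace $1$ (a.e.), and let $J=\begin{pmatrix}0&-1\\1&0\end{pmatrix}$. For $z\in\mathbb C$ let $M(x,z)$, $x\in[0,L]$, be the (absolutely continuous) matrix solution of the canonical system $$J\,\frac{dY}{dx}=z\,\mathcal H\,Y \quad\text{a.e. on }[0,L],\qquad M(0,z)=I,$$ and put $M(z)=M(L,z)$. The order of the system $(\mathcal H,L)$ is the common value of the orders $\limsup_{|z|\to\infty}\frac{\log\log|M_{ij}(z)|}{\log|z|}$ of the entire functions $M_{ij}$, $i,j\in\{1,2\}$ (constants have order $0$; in the limsup, $\log$ is replaced by $\log^+=\max(0,\log)$ where necessary). Let $\mathfrak H_1=\begin{pmatrix}1&0\\0&0\end{pmatrix}$, $\mathfrak H_2=\begin{pmatrix}0&0\\0&1\end{pmatrix}$, and suppose that for a.e. $x\in[0,L]$ either $\mathcal H(x)=\mathfrak H_1$ or $\mathcal H(x)=\mathfrak H_2$. Let $X_k=\{x\in(0,L):\mathcal H(x)=\mathfrak H_k\}$, $k=1,2$, and let $|\cdot|$ be Lebesgue measure.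 Then the order of the system $(\mathcal H,L)$ (the order of each $M_{ij}$) equals the infimum of those $d$, $0<d<1$, for which there is a constant $C=C(d)>0$ such that for every sufficiently large $R$ there exists a covering of $(0,L)$ by $n=n(R)$ intervals $\omega_j$ with (A) $\displaystyle\sum_{j}\sqrt{|\omega_j\cap X_1|\,|\omega_j\cap X_2|}\le C R^{d-1}$; (B) $n(R)\le C R^{d}$, where the infimum is understood to be $1$ if there are no such $d$. -/

import Mathlib

open MeasureTheory Filter Set

noncomputable section

/-- A (trace-normed) canonical system `(H, L)`: a number `L > 0` and a summable Hamiltonian `H` on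
`[0, L]` with values in the nonnegative `2 × 2` matrices of trace one. Values of `H` outside
`[0, L]` are irrelevant. -/
structure CanonicalSystem where
  /-- the length of the interval -/
  L : ℝ
  L_pos : 0 < L
  /-- the Hamiltonian -/
  H : ℝ → Matrix (Fin 2) (Fin 2) ℝ
  integrable : ∀ i j, IntegrableOn (fun x => H x i j) (Icc 0 L)
  posSemidef : ∀ᵐ x ∂volume.restrict (Icc 0 L), (H x).PosSemidef
  trace_eq_one : ∀ᵐ x ∂volume.restrict (Icc 0 L), (H x).trace = 1

namespace CanonicalSystem

/-- The symplectic matrix `J`. -/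
def J : Matrix (Fin 2) (Fin 2) ℂ := !![0, -1; 1, 0]

/-- The matrix `diag(1, 0)`. -/
def H₁ : Matrix (Fin 2) (Fin 2) ℝ := !![1, 0; 0, 0]

/-- The matrix `diag(0, 1)`. -/
def H₂ : Matrix (Fin 2) (Fin 2) ℝ := !![0, 0; 0, 1]

/-- `M x z` is the matrix solution of the system `J dY/dx = z H Y`, `x ∈ [0, L]`, `z ∈ ℂ`, with
`M 0 z = I`. As `H` is only summable, a solution is an absolutely continuous function satisfying
the equation almost everywhere. -/
structure IsMonodromy (S : CanonicalSystem) (M : ℝ → ℂ → Matrix (Fin 2) (Fin 2) ℂ) : Prop where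
  initial : ∀ z, M 0 z = 1
  absolutelyContinuous : ∀ z i j, AbsolutelyContinuousOnInterval (fun x => M x z i j) 0 S.L
  equation : ∀ z, ∀ᵐ x ∂volume.restrict (Icc 0 S.L),
    ∃ M' : Matrix (Fin 2) (Fin 2) ℂ, (∀ i j, HasDerivAt (fun t => M t z i j) (M' i j) x) ∧
      J * M' = z • ((S.H x).map Complex.ofReal * M x z)

/-- `X₁ = {x ∈ (0, L) : H x = diag(1, 0)}`. -/
def X₁ (S : CanonicalSystem) : Set ℝ := {x ∈ Ioo 0 S.L | S.H x = H₁}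

/-- `X₂ = {x ∈ (0, L) : H x = diag(0, 1)}`. -/
def X₂ (S : CanonicalSystem) : Set ℝ := {x ∈ Ioo 0 S.L | S.H x = H₂}

/-- The set of those `d ∈ (0, 1)` for which there is `C > 0` such that for all large `R` the
interval `(0, L)` has a covering by `n` intervals `ω j` satisfying
(A) `∑ √(|ω j ∩ X₁| |ω j ∩ X₂|) ≤ C R ^ (d - 1)` and (B) `n ≤ C R ^ d`.
Intervals of all kinds are admitted: they are the order-connected subsets of `ℝ`. -/
def coveringExponents (S : CanonicalSystem) : Set ℝ :=
  {d | 0 < d ∧ d < 1 ∧ ∃ C : ℝ, 0 < C ∧ ∀ᶠ R : ℝ in atTop,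
    ∃ (n : ℕ) (ω : Fin n → Set ℝ), (∀ j, (ω j).OrdConnected) ∧ Ioo 0 S.L ⊆ ⋃ j, ω j ∧
      ∑ j, √(volume.real (ω j ∩ S.X₁) * volume.real (ω j ∩ S.X₂)) ≤ C * R ^ (d - 1) ∧
      (n : ℝ) ≤ C * R ^ d}

end CanonicalSystem

/-- The order of an entire function, `limsup_{|z| → ∞} log log |f z| / log |z|`. The positive
parts of the logarithms only serve to make the quotient meaningful where `|f z| ≤ e`; the order of
a nonconstant `f` is not affected by them, and a constant gets order `0`. -/
def growthOrder (f : ℂ → ℂ) : EReal :=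
  limsup (fun z : ℂ => ((Real.posLog (Real.posLog ‖f z‖) / Real.log ‖z‖ : ℝ) : EReal))
    (Bornology.cobounded ℂ)

end

open MeasureTheory Filter Set

noncomputable section

/-! With `h` and `k` the indicators of `X₂` and `X₁`, each column `(f, g)` of `M` solves `f' = z h
g`, `g' = -z k f`. Its Neumann series has nonnegative iterated integrals as coefficients, so on `|z|
= r` each entry is dominated by the series of the positive system `u' = r h w`, `w' = r k u`, and `z
= ± i r` attains this bound (`neumannSum_majorant`). The order is therefore decided by the growth in
`r` of positive, monotone solutions.

Upper bound: over an interval carrying masses `A` of `h` and `B` of `k`, the norm `u + μ w` with `μ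
≈ √(A / B)` grows at most by `exp (c r √(A B))`, and passing to and from this norm costs a power of
`r` (`add_le_exp_sqrt`). Multiplying over a covering gives an exponent `O(r ∑ √(A B) + n (1 + log
r))`, which is `O(r ^ d (1 + log r))` under (A) and (B); the logarithm does not affect the order.

Lower bound: cut `[0, L]` greedily into intervals with `r ^ 2 A B = 1`. On each of them the product
of the two diagonal entries increases by the factor `5 / 4` (`diagonal_growth`), so growth `exp (r ^
d)` forces `n = O(r ^ d)`, which is (B). Each term in (A) is at most `1 / r`, so the sum is `O(r ^
(d - 1))` (`exists_cover`, `exists_cover_of_growth`).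

Growth of a single entry suffices, since every entry controls both diagonal ones up to a polynomial
factor (`neumannSum_diagonal_le`). -/

/-- A measurable density with values in `[0, 1]`. -/
structure IsWeight (h : ℝ → ℝ) : Prop where
  aestronglyMeasurable : AEStronglyMeasurable h volume
  nonneg : ∀ x, 0 ≤ h x
  le_one : ∀ x, h x ≤ 1

namespace IsWeight

variable {h k : ℝ → ℝ}

lemma intervalIntegrable (hh : IsWeight h) (a b : ℝ) : IntervalIntegrable h volume a b := by
  refine (intervalIntegrable_const (c := (1 : ℝ))).mono_fun hh.aestronglyMeasurable.restrict ?_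
  refine ae_of_all _ fun x => ?_
  simpa [abs_of_nonneg (hh.nonneg x)] using hh.le_one x

lemma intervalIntegrable_smul {E : Type*} [NormedAddCommGroup E] [NormedSpace ℝ E]
    (hh : IsWeight h) {g : ℝ → E} {a b : ℝ} (hg : ContinuousOn g (uIcc a b)) :
    IntervalIntegrable (fun t => h t • g t) volume a b :=
  (hh.intervalIntegrable a b).smul_continuousOn hg

end IsWeight

/-! ### Iterated integrals with alternating weights -/

/-- The iterated integrals `∫_{x > t₁ > t₂ > ⋯ > tₙ > 0} h(t₁) k(t₂) h(t₃) ⋯`. -/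
def iteratedWeight : (ℝ → ℝ) → (ℝ → ℝ) → ℕ → ℝ → ℝ
  | _, _, 0 => fun _ => 1
  | h, k, n + 1 => fun x => ∫ t in 0..x, h t • iteratedWeight k h n t

section iteratedWeight

variable {h k : ℝ → ℝ}

lemma continuous_iteratedWeight (hh : IsWeight h) (hk : IsWeight k) (n : ℕ) :
    Continuous (iteratedWeight h k n) := by
  induction n generalizing h k with
  | zero => exact continuous_const
  | succ n ih =>
    exact intervalIntegral.continuous_primitive
      (fun a b => hh.intervalIntegrable_smul (ih hk hh).continuousOn) 0

lemma iteratedWeight_nonneg (hh : IsWeight h) (hk : IsWeight k) (n : ℕ) {x : ℝ} (hx : 0 ≤ x) :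
    0 ≤ iteratedWeight h k n x := by
  induction n generalizing h k x with
  | zero => exact zero_le_one
  | succ n ih =>
    exact intervalIntegral.integral_nonneg hx fun t ht =>
      mul_nonneg (hh.nonneg t) (ih hk hh ht.1)

lemma intervalIntegrable_weight_mul_iteratedWeight (hh : IsWeight h) (hk : IsWeight k) (n : ℕ)
    (a b : ℝ) : IntervalIntegrable (fun t => h t • iteratedWeight k h n t) volume a b :=
  hh.intervalIntegrable_smul (continuous_iteratedWeight hk hh n).continuousOn

/-- Replacing the weights by `1` leaves the volume of a simplex. This makes the Neumann series
converge. -/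
lemma iteratedWeight_le (hh : IsWeight h) (hk : IsWeight k) (n : ℕ) {x : ℝ} (hx : 0 ≤ x) :
    iteratedWeight h k n x ≤ x ^ n / n.factorial := by
  induction n generalizing h k x with
  | zero => simp [iteratedWeight]
  | succ n ih =>
    have : ∫ t in (0 : ℝ)..x, t ^ n / n.factorial = x ^ (n + 1) / (n + 1).factorial := by
      rw [intervalIntegral.integral_div, integral_pow, Nat.factorial_succ]
      push_cast
      field_simp
      simp
    rw [← this]
    refine intervalIntegral.integral_mono_on hx
      (intervalIntegrable_weight_mul_iteratedWeight hh hk n 0 x)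
      (Continuous.intervalIntegrable (by fun_prop) 0 x) ?_
    intro t ht
    calc h t • iteratedWeight k h n t ≤ 1 * iteratedWeight k h n t :=
          mul_le_mul_of_nonneg_right (hh.le_one t) (iteratedWeight_nonneg hk hh n ht.1)
      _ ≤ _ := by rw [one_mul]; exact ih hk hh ht.1

lemma monotoneOn_iteratedWeight (hh : IsWeight h) (hk : IsWeight k) (n : ℕ) :
    MonotoneOn (iteratedWeight h k n) (Ici 0) := by
  cases n with
  | zero => exact fun _ _ _ _ _ => le_rfl
  | succ n =>
    intro x hx y hy hxy
    refine intervalIntegral.integral_mono_interval le_rfl hx hxy ?_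
      (intervalIntegrable_weight_mul_iteratedWeight hh hk n 0 y)
    filter_upwards [ae_restrict_mem measurableSet_Ioc] with t ht
    exact mul_nonneg (hh.nonneg t) (iteratedWeight_nonneg hk hh n ht.1.le)

/-- Dropping the outermost integration. -/
lemma iteratedWeight_succ_le_swap (hh : IsWeight h) (hk : IsWeight k) (n : ℕ) {x : ℝ}
    (hx : 0 ≤ x) : iteratedWeight h k (n + 1) x ≤ x * iteratedWeight k h n x := by
  have : ∫ _ in (0 : ℝ)..x, iteratedWeight k h n x = x * iteratedWeight k h n x := by simp
  rw [← this]
  refine intervalIntegral.integral_mono_on hx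
    (intervalIntegrable_weight_mul_iteratedWeight hh hk n 0 x) intervalIntegrable_const ?_
  intro t ht
  calc h t • iteratedWeight k h n t ≤ 1 * iteratedWeight k h n t :=
        mul_le_mul_of_nonneg_right (hh.le_one t) (iteratedWeight_nonneg hk hh n ht.1)
    _ ≤ _ := by rw [one_mul]; exact monotoneOn_iteratedWeight hk hh n ht.1 hx ht.2

/-- Dropping the innermost integration. -/
lemma iteratedWeight_succ_le (hh : IsWeight h) (hk : IsWeight k) (n : ℕ) {x L : ℝ}
    (hx : 0 ≤ x) (hL : x ≤ L) : iteratedWeight h k (n + 1) x ≤ L * iteratedWeight h k n x := by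
  induction n generalizing h k x with
  | zero =>
    have := iteratedWeight_succ_le_swap hh hk 0 hx
    simp only [iteratedWeight, mul_one] at this ⊢
    linarith
  | succ n ih =>
    have e : L * iteratedWeight h k (n + 1) x
        = ∫ t in 0..x, L * (h t • iteratedWeight k h n t) := by
      rw [intervalIntegral.integral_const_mul]; rfl
    rw [e]
    refine intervalIntegral.integral_mono_on hx
      (intervalIntegrable_weight_mul_iteratedWeight hh hk (n + 1) 0 x)
      ((intervalIntegrable_weight_mul_iteratedWeight hh hk n 0 x).const_mul L) ?_
    intro t ht
    calc h t • iteratedWeight k h (n + 1) t ≤ h t * (L * iteratedWeight k h n t) :=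
          mul_le_mul_of_nonneg_left (ih hk hh ht.1 (ht.2.trans hL)) (hh.nonneg t)
      _ = _ := by rw [smul_eq_mul]; ring

end iteratedWeight

/-! ### Neumann series of the off-diagonal system -/

/-- The coefficients of the Neumann series of the system `f' = α h g`, `g' = β k f` with initial
values `a`, `b`. -/
def neumannCoeff {R : Type*} [Mul R] : R → R → R → R → ℕ → R
  | _, _, a, _, 0 => a
  | α, β, a, b, n + 1 => α * neumannCoeff β α b a n

/-- Continuous solutions of the system `f' = α h g`, `g' = β k f` on `[0, L]` with `f 0 = a` and
`g 0 = b`, in integrated form. -/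
structure IsSolution {𝕜 : Type*} [RCLike 𝕜] (h k : ℝ → ℝ) (L : ℝ) (α β a b : 𝕜) (f g : ℝ → 𝕜) :
    Prop where
  continuousOn_fst : ContinuousOn f (Icc 0 L)
  continuousOn_snd : ContinuousOn g (Icc 0 L)
  fst_eq : ∀ x ∈ Icc 0 L, f x = a + α * ∫ t in 0..x, h t • g t
  snd_eq : ∀ x ∈ Icc 0 L, g x = b + β * ∫ t in 0..x, k t • f t

section RCLike

variable {𝕜 : Type*} [RCLike 𝕜] {h k : ℝ → ℝ} {L : ℝ} {α β a b : 𝕜} {f g : ℝ → 𝕜}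

lemma IsSolution.swap (hs : IsSolution h k L α β a b f g) : IsSolution k h L β α b a g f :=
  ⟨hs.2, hs.1, hs.4, hs.3⟩

lemma norm_neumannCoeff_le (n : ℕ) {r : ℝ} (hα : ‖α‖ ≤ r) (hβ : ‖β‖ ≤ r) :
    ‖neumannCoeff α β a b n‖ ≤ neumannCoeff r r ‖a‖ ‖b‖ n := by
  induction n generalizing α β a b with
  | zero => exact le_rfl
  | succ n ih =>
    simp only [neumannCoeff, norm_mul]
    exact mul_le_mul hα (ih hβ hα) (norm_nonneg _) ((norm_nonneg _).trans hα)

/-- The remainder of order `n + 1` for `f` is `α` times the `h`-integral of the remainder of order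
`n` for `g`. The induction therefore alternates between the system and its swap, gaining one
integration each time. -/
lemma IsSolution.norm_sub_sum_le (hh : IsWeight h) (hk : IsWeight k)
    (hs : IsSolution h k L α β a b f g) {r K : ℝ} (hα : ‖α‖ ≤ r) (hβ : ‖β‖ ≤ r)
    (hf : ∀ x ∈ Icc 0 L, ‖f x‖ ≤ K) (hg : ∀ x ∈ Icc 0 L, ‖g x‖ ≤ K) (n : ℕ) {x : ℝ}
    (hx : x ∈ Icc 0 L) :
    ‖f x - ∑ m ∈ Finset.range n, iteratedWeight h k m x • neumannCoeff α β a b m‖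
      ≤ K * ((r * x) ^ n / n.factorial) := by
  have hr : 0 ≤ r := (norm_nonneg _).trans hα
  induction n generalizing h k α β a b f g x with
  | zero => simpa using hf x hx
  | succ n ih =>
    have hsub : uIcc 0 x ⊆ Icc 0 L := by
      rw [uIcc_of_le hx.1]; exact Icc_subset_Icc le_rfl hx.2
    have hi1 : IntervalIntegrable (fun t => h t • g t) volume 0 x :=
      hh.intervalIntegrable_smul (hs.continuousOn_snd.mono hsub)
    have hc (m : ℕ) : Continuous fun t => iteratedWeight k h m t • neumannCoeff β α b a m :=
      (continuous_iteratedWeight hk hh m).smul continuous_const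
    have hi2 (m : ℕ) : IntervalIntegrable
        (fun t => h t • (iteratedWeight k h m t • neumannCoeff β α b a m)) volume 0 x :=
      hh.intervalIntegrable_smul (hc m).continuousOn
    have key : f x - ∑ m ∈ Finset.range (n + 1), iteratedWeight h k m x • neumannCoeff α β a b m
        = α * ∫ t in 0..x, h t •
          (g t - ∑ m ∈ Finset.range n, iteratedWeight k h m t • neumannCoeff β α b a m) := by
      have hi3 : IntervalIntegrable (fun t => ∑ m ∈ Finset.range n,
          h t • (iteratedWeight k h m t • neumannCoeff β α b a m)) volume 0 x := by
        simpa only [Finset.smul_sum] using hh.intervalIntegrable_smul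
          (continuous_finsetSum (Finset.range n) fun m _ => hc m).continuousOn
      simp only [smul_sub, Finset.smul_sum]
      rw [intervalIntegral.integral_sub hi1 hi3,
        intervalIntegral.integral_finsetSum fun m _ => hi2 m, Finset.sum_range_succ',
        hs.fst_eq x hx]
      have e (m : ℕ) : iteratedWeight h k (m + 1) x • neumannCoeff α β a b (m + 1)
          = α * ∫ t in 0..x, h t • (iteratedWeight k h m t • neumannCoeff β α b a m) := by
        simp only [← smul_assoc]
        rw [intervalIntegral.integral_smul_const]
        simp [iteratedWeight, neumannCoeff]
      simp only [e, ← Finset.mul_sum]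
      simp only [iteratedWeight, neumannCoeff, one_smul]
      ring
    have hint : ∫ t in (0 : ℝ)..x, K * ((r * t) ^ n / n.factorial)
        = K * (r ^ n * x ^ (n + 1) / (n + 1).factorial) := by
      simp only [mul_pow]
      rw [intervalIntegral.integral_const_mul, intervalIntegral.integral_div,
        intervalIntegral.integral_const_mul, integral_pow, Nat.factorial_succ]
      push_cast
      field_simp
      simp
    rw [key, norm_mul]
    have hb : ‖∫ t in 0..x, h t •
        (g t - ∑ m ∈ Finset.range n, iteratedWeight k h m t • neumannCoeff β α b a m)‖
        ≤ K * (r ^ n * x ^ (n + 1) / (n + 1).factorial) := by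
      rw [← hint]
      refine intervalIntegral.norm_integral_le_of_norm_le hx.1 (ae_of_all _ fun t ht => ?_)
        (Continuous.intervalIntegrable (by fun_prop) 0 x)
      have htL : t ∈ Icc 0 L := ⟨ht.1.le, ht.2.trans hx.2⟩
      rw [norm_smul, Real.norm_of_nonneg (hh.nonneg t)]
      calc _ ≤ 1 * _ := mul_le_mul_of_nonneg_right (hh.le_one t) (norm_nonneg _)
        _ ≤ _ := by rw [one_mul]; exact ih hk hh hs.swap hβ hα hg hf htL
    calc _ ≤ r * (K * (r ^ n * x ^ (n + 1) / (n + 1).factorial)) := by gcongr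
      _ = _ := by ring

lemma summable_neumann (hh : IsWeight h) (hk : IsWeight k) (r a b : ℝ) (hr : 0 ≤ r) (ha : 0 ≤ a)
    (hb : 0 ≤ b) {x : ℝ} (hx : 0 ≤ x) :
    Summable fun m => iteratedWeight h k m x * neumannCoeff r r a b m := by
  have hc (m : ℕ) (a b : ℝ) (ha : 0 ≤ a) (hb : 0 ≤ b) : 0 ≤ neumannCoeff r r a b m ∧
      neumannCoeff r r a b m ≤ r ^ m * (a + b) := by
    induction m generalizing a b with
    | zero => simpa [neumannCoeff] using ⟨ha, hb⟩
    | succ m ih =>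
      obtain ⟨h1, h2⟩ := ih b a hb ha
      refine ⟨mul_nonneg hr h1, ?_⟩
      calc r * neumannCoeff r r b a m ≤ r * (r ^ m * (b + a)) := by gcongr
        _ = _ := by ring
  refine Summable.of_nonneg_of_le
    (fun m => mul_nonneg (iteratedWeight_nonneg hh hk m hx) (hc m a b ha hb).1)
    (fun m => ?_) ((Real.summable_pow_div_factorial (r * x)).mul_left (a + b))
  calc _ ≤ x ^ m / m.factorial * (r ^ m * (a + b)) :=
        mul_le_mul (iteratedWeight_le hh hk m hx) (hc m a b ha hb).2 (hc m a b ha hb).1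
          (by positivity)
    _ = _ := by ring

lemma IsSolution.hasSum (hh : IsWeight h) (hk : IsWeight k)
    (hs : IsSolution h k L α β a b f g) {x : ℝ} (hx : x ∈ Icc 0 L) :
    HasSum (fun m => iteratedWeight h k m x • neumannCoeff α β a b m) (f x) := by
  obtain ⟨K₁, hK₁⟩ := isCompact_Icc.exists_bound_of_continuousOn hs.continuousOn_fst
  obtain ⟨K₂, hK₂⟩ := isCompact_Icc.exists_bound_of_continuousOn hs.continuousOn_snd
  set r := max ‖α‖ ‖β‖ with hr
  have hα : ‖α‖ ≤ r := le_max_left _ _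
  have hβ : ‖β‖ ≤ r := le_max_right _ _
  have hsum : Summable (fun m => iteratedWeight h k m x • neumannCoeff α β a b m) := by
    refine Summable.of_norm_bounded (summable_neumann hh hk r ‖a‖ ‖b‖
      ((norm_nonneg _).trans hα) (norm_nonneg _) (norm_nonneg _) hx.1) fun m => ?_
    rw [norm_smul, Real.norm_of_nonneg (iteratedWeight_nonneg hh hk m hx.1)]
    exact mul_le_mul_of_nonneg_left (norm_neumannCoeff_le m hα hβ)
      (iteratedWeight_nonneg hh hk m hx.1)
  rw [hsum.hasSum_iff_tendsto_nat, tendsto_iff_norm_sub_tendsto_zero]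
  refine squeeze_zero (fun _ => norm_nonneg _) (fun n => ?_)
    (g := fun n => max K₁ K₂ * ((r * x) ^ n / n.factorial)) ?_
  · rw [norm_sub_rev]
    exact hs.norm_sub_sum_le hh hk hα hβ (fun y hy => (hK₁ y hy).trans (le_max_left _ _))
      (fun y hy => (hK₂ y hy).trans (le_max_right _ _)) n hx
  · simpa using (FloorSemiring.tendsto_pow_div_factorial_atTop (r * x)).const_mul (max K₁ K₂)

end RCLike

/-! ### The positive system: domination and monotonicity -/

/-- The Neumann series of the positive system `f' = r h g`, `g' = r k f`. -/
def neumannSum (h k : ℝ → ℝ) (r a b x : ℝ) : ℝ :=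
  ∑' m, iteratedWeight h k m x * neumannCoeff r r a b m

section Positive

variable {h k : ℝ → ℝ} {L r a b : ℝ} {u w : ℝ → ℝ}

lemma neumannCoeff_nonneg (hr : 0 ≤ r) (ha : 0 ≤ a) (hb : 0 ≤ b) (m : ℕ) :
    0 ≤ neumannCoeff r r a b m := by
  induction m generalizing a b with
  | zero => exact ha
  | succ m ih => exact mul_nonneg hr (ih hb ha)

lemma neumannSum_nonneg (hh : IsWeight h) (hk : IsWeight k) (hr : 0 ≤ r) (ha : 0 ≤ a)
    (hb : 0 ≤ b) {x : ℝ} (hx : 0 ≤ x) : 0 ≤ neumannSum h k r a b x :=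
  tsum_nonneg fun m =>
    mul_nonneg (iteratedWeight_nonneg hh hk m hx) (neumannCoeff_nonneg hr ha hb m)

lemma neumannSum_eq_add (hh : IsWeight h) (hk : IsWeight k) (hr : 0 ≤ r) (ha : 0 ≤ a)
    (hb : 0 ≤ b) {x : ℝ} (hx : 0 ≤ x) : neumannSum h k r a b x
      = a + ∑' m, iteratedWeight h k (m + 1) x * (r * neumannCoeff r r b a m) := by
  rw [neumannSum, (summable_neumann hh hk r a b hr ha hb hx).tsum_eq_zero_add]
  simp [iteratedWeight, neumannCoeff]

/-- Dropping the outermost integral compares the two components of one solution, that is, two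
entries in the same column of the fundamental matrix. -/
lemma neumannSum_le_swap (hh : IsWeight h) (hk : IsWeight k) (hr : 0 ≤ r) (ha : 0 ≤ a)
    (hb : 0 ≤ b) {x : ℝ} (hx : 0 ≤ x) :
    neumannSum h k r a b x ≤ a + r * x * neumannSum k h r b a x := by
  rw [neumannSum_eq_add hh hk hr ha hb hx, neumannSum, ← tsum_mul_left]
  have hS := (summable_nat_add_iff 1).2 (summable_neumann hh hk r a b hr ha hb hx)
  refine add_le_add_right (hS.tsum_le_tsum (fun m => ?_)
    ((summable_neumann hk hh r b a hr hb ha hx).mul_left _)) a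
  calc _ ≤ (x * iteratedWeight k h m x) * (r * neumannCoeff r r b a m) :=
        mul_le_mul_of_nonneg_right (iteratedWeight_succ_le_swap hh hk m hx)
          (mul_nonneg hr (neumannCoeff_nonneg hr hb ha m))
    _ = _ := by ring

/-- Dropping the innermost integral keeps the component and exchanges the initial values. This
compares two entries in the same row. -/
lemma neumannSum_le (hh : IsWeight h) (hk : IsWeight k) (hr : 0 ≤ r) (ha : 0 ≤ a)
    (hb : 0 ≤ b) {x : ℝ} (hx : 0 ≤ x) :
    neumannSum h k r a b x ≤ a + r * x * neumannSum h k r b a x := by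
  rw [neumannSum_eq_add hh hk hr ha hb hx, neumannSum, ← tsum_mul_left]
  have hS := (summable_nat_add_iff 1).2 (summable_neumann hh hk r a b hr ha hb hx)
  refine add_le_add_right (hS.tsum_le_tsum (fun m => ?_)
    ((summable_neumann hh hk r b a hr hb ha hx).mul_left _)) a
  calc _ ≤ (x * iteratedWeight h k m x) * (r * neumannCoeff r r b a m) :=
        mul_le_mul_of_nonneg_right (iteratedWeight_succ_le hh hk m hx le_rfl)
          (mul_nonneg hr (neumannCoeff_nonneg hr hb ha m))
    _ = _ := by ring

lemma IsSolution.eq_neumannSum (hh : IsWeight h) (hk : IsWeight k)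
    (hs : IsSolution h k L r r a b u w) {x : ℝ} (hx : x ∈ Icc 0 L) :
    u x = neumannSum h k r a b x :=
  (hs.hasSum hh hk hx).tsum_eq.symm

lemma IsSolution.norm_le_neumannSum {𝕜 : Type*} [RCLike 𝕜] {α β a b : 𝕜} {f g : ℝ → 𝕜}
    (hh : IsWeight h) (hk : IsWeight k) (hs : IsSolution h k L α β a b f g)
    (hα : ‖α‖ ≤ r) (hβ : ‖β‖ ≤ r) {x : ℝ} (hx : x ∈ Icc 0 L) :
    ‖f x‖ ≤ neumannSum h k r ‖a‖ ‖b‖ x := by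
  have hr := (norm_nonneg _).trans hα
  rw [← (hs.hasSum hh hk hx).tsum_eq]
  refine tsum_of_norm_bounded (summable_neumann hh hk r ‖a‖ ‖b‖ hr (norm_nonneg _)
    (norm_nonneg _) hx.1).hasSum fun m => ?_
  rw [norm_smul, Real.norm_of_nonneg (iteratedWeight_nonneg hh hk m hx.1)]
  exact mul_le_mul_of_nonneg_left (norm_neumannCoeff_le m hα hβ)
    (iteratedWeight_nonneg hh hk m hx.1)

namespace IsSolution

/-- Positivity is read off the series; monotonicity and the one-step estimates rest on it. -/
lemma fst_nonneg (hs : IsSolution h k L r r a b u w) (hh : IsWeight h) (hk : IsWeight k)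
    (hr : 0 ≤ r) (ha : 0 ≤ a) (hb : 0 ≤ b) {x : ℝ} (hx : x ∈ Icc 0 L) : 0 ≤ u x := by
  rw [hs.eq_neumannSum hh hk hx]
  exact neumannSum_nonneg hh hk hr ha hb hx.1

lemma intervalIntegrable_snd (hs : IsSolution h k L r r a b u w) (hh : IsWeight h) {x y : ℝ}
    (hx : x ∈ Icc 0 L) (hy : y ∈ Icc 0 L) :
    IntervalIntegrable (fun t => h t • w t) volume x y :=
  hh.intervalIntegrable_smul (hs.continuousOn_snd.mono (ordConnected_Icc.uIcc_subset hx hy))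

lemma fst_sub (hs : IsSolution h k L r r a b u w) (hh : IsWeight h) {x y : ℝ}
    (hx : x ∈ Icc 0 L) (hy : y ∈ Icc 0 L) : u y - u x = r * ∫ t in x..y, h t • w t := by
  have h0 : (0 : ℝ) ∈ Icc 0 L := ⟨le_rfl, hx.1.trans hx.2⟩
  rw [hs.fst_eq x hx, hs.fst_eq y hy, ← intervalIntegral.integral_interval_sub_left
    (hs.intervalIntegrable_snd hh h0 hy) (hs.intervalIntegrable_snd hh h0 hx)]
  ring

lemma fst_mono (hs : IsSolution h k L r r a b u w) (hh : IsWeight h) (hk : IsWeight k)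
    (hr : 0 ≤ r) (ha : 0 ≤ a) (hb : 0 ≤ b) {x y : ℝ} (hx : 0 ≤ x) (hxy : x ≤ y) (hy : y ≤ L) :
    u x ≤ u y := by
  rw [← sub_nonneg, hs.fst_sub hh ⟨hx, hxy.trans hy⟩ ⟨hx.trans hxy, hy⟩]
  refine mul_nonneg hr (intervalIntegral.integral_nonneg hxy fun t ht => ?_)
  exact mul_nonneg (hh.nonneg t)
    (hs.swap.fst_nonneg hk hh hr hb ha ⟨hx.trans ht.1, ht.2.trans hy⟩)

lemma le_fst (hs : IsSolution h k L r r a b u w) (hh : IsWeight h) (hk : IsWeight k)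
    (hr : 0 ≤ r) (ha : 0 ≤ a) (hb : 0 ≤ b) {x y : ℝ} (hx : 0 ≤ x) (hxy : x ≤ y) (hy : y ≤ L) :
    u x + r * w x * (∫ t in x..y, h t) ≤ u y := by
  have e := hs.fst_sub hh ⟨hx, hxy.trans hy⟩ ⟨hx.trans hxy, hy⟩
  have : w x * (∫ t in x..y, h t) ≤ ∫ t in x..y, h t • w t := by
    rw [← intervalIntegral.integral_const_mul]
    refine intervalIntegral.integral_mono_on hxy ((hh.intervalIntegrable x y).const_mul _)
      (hs.intervalIntegrable_snd hh ⟨hx, hxy.trans hy⟩ ⟨hx.trans hxy, hy⟩) fun t ht => ?_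
    rw [smul_eq_mul, mul_comm]
    exact mul_le_mul_of_nonneg_left (hs.swap.fst_mono hk hh hr hb ha hx ht.1 (ht.2.trans hy))
      (hh.nonneg t)
  have := mul_le_mul_of_nonneg_left this hr
  linarith

lemma fst_le (hs : IsSolution h k L r r a b u w) (hh : IsWeight h) (hk : IsWeight k)
    (hr : 0 ≤ r) (ha : 0 ≤ a) (hb : 0 ≤ b) {x y : ℝ} (hx : 0 ≤ x) (hxy : x ≤ y) (hy : y ≤ L) :
    u y ≤ u x + r * w y * (∫ t in x..y, h t) := by
  have e := hs.fst_sub hh ⟨hx, hxy.trans hy⟩ ⟨hx.trans hxy, hy⟩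
  have : (∫ t in x..y, h t • w t) ≤ w y * (∫ t in x..y, h t) := by
    rw [← intervalIntegral.integral_const_mul]
    refine intervalIntegral.integral_mono_on hxy
      (hs.intervalIntegrable_snd hh ⟨hx, hxy.trans hy⟩ ⟨hx.trans hxy, hy⟩)
      ((hh.intervalIntegrable x y).const_mul _) fun t ht => ?_
    rw [smul_eq_mul, mul_comm (w y)]
    exact mul_le_mul_of_nonneg_left (hs.swap.fst_mono hk hh hr hb ha (hx.trans ht.1) ht.2 hy)
      (hh.nonneg t)
  have := mul_le_mul_of_nonneg_left this hr
  linarith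

lemma fst_zero (hs : IsSolution h k L r r a b u w) (hL : 0 ≤ L) : u 0 = a := by
  simp [hs.fst_eq 0 ⟨le_rfl, hL⟩]

/-! ### Growth of positive solutions over one interval -/

/-- If the total variation of the coefficients, in the norm with weight `μ`, is at most `n / 2`,
then the solution grows at most by the factor `2 ^ n`. -/
lemma add_mul_le_two_pow (hs : IsSolution h k L r r a b u w) (hh : IsWeight h) (hk : IsWeight k)
    (hr : 0 ≤ r) (ha : 0 ≤ a) (hb : 0 ≤ b) {μ : ℝ} (hμ : 0 < μ) (n : ℕ) {x y : ℝ}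
    (hx : 0 ≤ x) (hxy : x ≤ y) (hy : y ≤ L)
    (hn : r * ((∫ t in x..y, h t) / μ + μ * ∫ t in x..y, k t) ≤ n / 2) :
    u y + μ * w y ≤ 2 ^ n * (u x + μ * w x) := by
  have hint (p q : ℝ → ℝ) (hp : IsWeight p) (x y : ℝ) (hxy : x ≤ y) : 0 ≤ ∫ t in x..y, p t :=
    intervalIntegral.integral_nonneg hxy fun t _ => hp.nonneg t
  -- Monotonicity evaluates the integrands at the right endpoint, so the increment is at most `F`
  -- times the final norm. For `F ≤ 1 / 2` it can be absorbed, and the norm at most doubles.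
  have step (x y F : ℝ) (hx : 0 ≤ x) (hxy : x ≤ y) (hy : y ≤ L)
      (hF : r * ((∫ t in x..y, h t) / μ + μ * ∫ t in x..y, k t) ≤ F) :
      u y + μ * w y ≤ u x + μ * w x + F * (u y + μ * w y) := by
    have h1 := hs.fst_le hh hk hr ha hb hx hxy hy
    have h2 := hs.swap.fst_le hk hh hr hb ha hx hxy hy
    have hu := hs.fst_nonneg hh hk hr ha hb ⟨hx.trans hxy, hy⟩
    have hw := hs.swap.fst_nonneg hk hh hr hb ha ⟨hx.trans hxy, hy⟩
    have hA := hint h h hh x y hxy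
    have hB := hint k k hk x y hxy
    set A := ∫ t in x..y, h t
    set B := ∫ t in x..y, k t
    have h3 : r * (A / μ + μ * B) * (u y + μ * w y)
        = r * w y * A + μ * (r * u y * B) + (r * (A / μ) * u y + r * (μ * B) * (μ * w y)) := by
      field_simp
      ring
    have h4 : 0 ≤ r * (A / μ) * u y + r * (μ * B) * (μ * w y) := by positivity
    have h5 := mul_le_mul_of_nonneg_right hF (by positivity : 0 ≤ u y + μ * w y)
    have h6 := mul_le_mul_of_nonneg_left h2 hμ.le
    linarith
  induction n generalizing x with
  | zero =>
    have := step x y 0 hx hxy hy (by simpa using hn)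
    simpa using this
  | succ n ih =>
    set F : ℝ → ℝ := fun s => r * ((∫ t in x..s, h t) / μ + μ * ∫ t in x..s, k t) with hFdef
    have hFc : Continuous F := by
      have h1 := intervalIntegral.continuous_primitive hh.intervalIntegrable x
      have h2 := intervalIntegral.continuous_primitive hk.intervalIntegrable x
      fun_prop
    have half (s : ℝ) (hs1 : x ≤ s) (hs2 : s ≤ y) (hF : F s ≤ 1 / 2) :
        u s + μ * w s ≤ 2 * (u x + μ * w x) := by
      have := step x s (1 / 2) hx hs1 (hs2.trans hy) hF
      linarith
    by_cases hF : F y ≤ 1 / 2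
    · refine (half y hxy le_rfl hF).trans ?_
      have hp : 0 ≤ u x + μ * w x :=
        add_nonneg (hs.fst_nonneg hh hk hr ha hb ⟨hx, hxy.trans hy⟩)
          (mul_nonneg hμ.le (hs.swap.fst_nonneg hk hh hr hb ha ⟨hx, hxy.trans hy⟩))
      refine mul_le_mul_of_nonneg_right ?_ hp
      rw [pow_succ]
      linarith [one_le_pow₀ (M₀ := ℝ) one_le_two (n := n)]
    -- Cut off an initial piece of variation exactly `1 / 2`: it costs one factor `2`, and the rest
    -- falls under the induction hypothesis.
    · obtain ⟨s, ⟨hs1, hs2⟩, hs3⟩ := intermediate_value_Icc hxy hFc.continuousOn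
        (show (1 / 2 : ℝ) ∈ Icc (F x) (F y) from ⟨by simp [F], (not_le.1 hF).le⟩)
      have hsplit : F y = F s + r * ((∫ t in s..y, h t) / μ + μ * ∫ t in s..y, k t) := by
        simp only [hFdef]
        rw [← intervalIntegral.integral_add_adjacent_intervals (hh.intervalIntegrable x s)
          (hh.intervalIntegrable s y), ← intervalIntegral.integral_add_adjacent_intervals
          (hk.intervalIntegrable x s) (hk.intervalIntegrable s y)]
        ring
      have hFy : F y ≤ ((n + 1 : ℕ) : ℝ) / 2 := hn
      push_cast at hFy
      have h1 := ih (hx.trans hs1) hs2 (by linarith)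
      have h2 := half s hs1 hs2 hs3.le
      calc u y + μ * w y ≤ 2 ^ n * (u s + μ * w s) := h1
        _ ≤ 2 ^ n * (2 * (u x + μ * w x)) := by gcongr
        _ = _ := by ring

lemma add_mul_le_exp (hs : IsSolution h k L r r a b u w) (hh : IsWeight h) (hk : IsWeight k)
    (hr : 0 ≤ r) (ha : 0 ≤ a) (hb : 0 ≤ b) {μ F : ℝ} (hμ : 0 < μ) {x y : ℝ}
    (hx : 0 ≤ x) (hxy : x ≤ y) (hy : y ≤ L) (hF0 : 0 ≤ F)
    (hF : r * ((∫ t in x..y, h t) / μ + μ * ∫ t in x..y, k t) ≤ F) :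
    u y + μ * w y ≤ Real.exp (2 * F + 1) * (u x + μ * w x) := by
  have hn := Nat.le_ceil (2 * F)
  have hn' := (Nat.ceil_lt_add_one (by positivity : 0 ≤ 2 * F)).le
  have := hs.add_mul_le_two_pow hh hk hr ha hb hμ ⌈2 * F⌉₊ hx hxy hy (by linarith)
  refine this.trans (mul_le_mul_of_nonneg_right ?_ ?_)
  · calc (2 : ℝ) ^ ⌈2 * F⌉₊ ≤ Real.exp 1 ^ ⌈2 * F⌉₊ := by
          gcongr
          linarith [Real.add_one_le_exp 1]
      _ = Real.exp ⌈2 * F⌉₊ := by rw [← Real.exp_nat_mul, mul_one]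
      _ ≤ _ := Real.exp_le_exp.2 hn'
  · exact add_nonneg (hs.fst_nonneg hh hk hr ha hb ⟨hx, hxy.trans hy⟩)
      (mul_nonneg hμ.le (hs.swap.fst_nonneg hk hh hr hb ha ⟨hx, hxy.trans hy⟩))

/-- The growth of a solution over an interval which carries the masses `A` of `h` and `B` of `k` is
controlled by `√(A * B)`. -/
lemma add_le_exp_sqrt (hs : IsSolution h k L r r a b u w) (hh : IsWeight h) (hk : IsWeight k)
    (hr : 1 ≤ r) (ha : 0 ≤ a) (hb : 0 ≤ b) {A B x y : ℝ} (hx : 0 ≤ x) (hxy : x ≤ y) (hy : y ≤ L)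
    (hA : ∫ t in x..y, h t ≤ A) (hB : ∫ t in x..y, k t ≤ B) (hAL : A ≤ L) (hBL : B ≤ L) :
    u y + w y ≤ Real.exp (4 * r * √(A * B) + (4 * √(2 * L + 1) + 1 + Real.log ((L + 1) * r ^ 2)))
      * (u x + w x) := by
  have hr0 : 0 < r := by linarith
  have hL : 0 ≤ L := hx.trans (hxy.trans hy)
  have hA0 : 0 ≤ A := (intervalIntegral.integral_nonneg hxy fun t _ => hh.nonneg t).trans hA
  have hB0 : 0 ≤ B := (intervalIntegral.integral_nonneg hxy fun t _ => hk.nonneg t).trans hB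
  -- The ideal weight `√(A / B)` may degenerate. Adding `ε = r⁻²` to both masses keeps `μ` in `[1 /
  -- K, K]` with `K = √(L + 1) r`, while `r √((A + ε) (B + ε))` exceeds `r √(A B)` by a bounded
  -- amount only. Changing the norm before and after costs `K ^ 2`, the source of the logarithm.
  set ε : ℝ := (r ^ 2)⁻¹ with hε
  have hε0 : 0 < ε := by positivity
  have hε1 : ε ≤ 1 := inv_le_one_of_one_le₀ (one_le_pow₀ hr)
  set p := √(A + ε) with hp
  set q := √(B + ε) with hq
  have hp2 : p ^ 2 = A + ε := Real.sq_sqrt (by positivity)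
  have hq2 : q ^ 2 = B + ε := Real.sq_sqrt (by positivity)
  have hp0 : 0 < p := Real.sqrt_pos.2 (by positivity)
  have hq0 : 0 < q := Real.sqrt_pos.2 (by positivity)
  set K := √((L + 1) * r ^ 2) with hK
  have hK2 : K ^ 2 = (L + 1) * r ^ 2 := Real.sq_sqrt (by positivity)
  have hK1 : 1 ≤ K := by
    rw [hK, Real.one_le_sqrt]
    nlinarith [one_le_pow₀ hr (n := 2)]
  have hbd (A B : ℝ) (hA0 : 0 ≤ A) (hB0 : 0 ≤ B) (hAL : A ≤ L) : √(A + ε) ≤ K * √(B + ε) := by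
    rw [hK, ← Real.sqrt_mul (by positivity)]
    apply Real.sqrt_le_sqrt
    have : r ^ 2 * ε = 1 := by rw [hε]; field_simp
    calc A + ε ≤ (L + 1) * 1 := by linarith
      _ = (L + 1) * (r ^ 2 * ε) := by rw [this]
      _ ≤ (L + 1) * r ^ 2 * (B + ε) := by
        rw [← mul_assoc]
        exact mul_le_mul_of_nonneg_left (by linarith) (by positivity)
  set μ := p / q with hμ
  have hμ0 : 0 < μ := by positivity
  have hμK : μ ≤ K := (div_le_iff₀ hq0).2 (hbd A B hA0 hB0 hAL)
  have hKμ : 1 ≤ K * μ := by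
    rw [hμ, ← mul_div_assoc, one_le_div hq0]
    exact hbd B A hB0 hA0 hBL
  have hpq : p * q ≤ √(A * B) + √(2 * L + 1) / r := by
    rw [hp, hq, ← Real.sqrt_mul (by positivity)]
    have e : √(2 * L + 1) / r = √((2 * L + 1) * ε) := by
      rw [Real.sqrt_mul (by positivity), hε, Real.sqrt_inv, Real.sqrt_sq hr0.le]; rfl
    rw [e]
    refine Real.sqrt_le_iff.2 ⟨by positivity, ?_⟩
    have h1 := Real.sq_sqrt (by positivity : 0 ≤ A * B)
    have h2 := Real.sq_sqrt (by positivity : 0 ≤ (2 * L + 1) * ε)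
    have h3 : 0 ≤ √(A * B) * √((2 * L + 1) * ε) := by positivity
    have h4 : (A + B + ε) * ε ≤ (2 * L + 1) * ε :=
      mul_le_mul_of_nonneg_right (by linarith) hε0.le
    linear_combination h4 + 2 * h3 - h1 - h2
  have hF : r * ((∫ t in x..y, h t) / μ + μ * ∫ t in x..y, k t) ≤ 2 * r * (p * q) := by
    have h1 : (∫ t in x..y, h t) / μ ≤ p * q := by
      rw [div_le_iff₀ hμ0, hμ]
      have : p * q * (p / q) = p ^ 2 := by field_simp
      linarith
    have h2 : μ * (∫ t in x..y, k t) ≤ p * q := by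
      calc _ ≤ μ * q ^ 2 := by gcongr; linarith
        _ = p * q := by rw [hμ]; field_simp
    calc _ ≤ r * (p * q + p * q) := by gcongr
      _ = _ := by ring
  have main := hs.add_mul_le_exp hh hk hr0.le ha hb hμ0 hx hxy hy (by positivity) hF
  have hux := hs.fst_nonneg hh hk hr0.le ha hb ⟨hx, hxy.trans hy⟩
  have hwx := hs.swap.fst_nonneg hk hh hr0.le hb ha ⟨hx, hxy.trans hy⟩
  have huy := hs.fst_nonneg hh hk hr0.le ha hb ⟨hx.trans hxy, hy⟩
  have hwy := hs.swap.fst_nonneg hk hh hr0.le hb ha ⟨hx.trans hxy, hy⟩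
  have hexp : 2 * (2 * r * (p * q)) + 1 ≤ 4 * r * √(A * B) + (4 * √(2 * L + 1) + 1) := by
    have : 4 * r * (p * q) ≤ 4 * r * (√(A * B) + √(2 * L + 1) / r) := by gcongr
    have e : 4 * r * (√(A * B) + √(2 * L + 1) / r) = 4 * r * √(A * B) + 4 * √(2 * L + 1) := by
      field_simp
    linarith
  have hKexp : K ^ 2 = Real.exp (Real.log ((L + 1) * r ^ 2)) := by
    rw [hK2, Real.exp_log (by positivity)]
  calc u y + w y ≤ K * (u y + μ * w y) := by
        have h1 := mul_le_mul_of_nonneg_right hK1 huy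
        have h2 := mul_le_mul_of_nonneg_right hKμ hwy
        linarith
    _ ≤ K * (Real.exp (2 * (2 * r * (p * q)) + 1) * (u x + μ * w x)) := by gcongr
    _ ≤ K * (Real.exp (4 * r * √(A * B) + (4 * √(2 * L + 1) + 1)) * (K * (u x + w x))) := by
        gcongr
        have h1 := mul_le_mul_of_nonneg_right hK1 hux
        have h2 := mul_le_mul_of_nonneg_right hμK hwx
        linarith
    _ = K ^ 2 * Real.exp (4 * r * √(A * B) + (4 * √(2 * L + 1) + 1)) * (u x + w x) := by ring
    _ = _ := by
        rw [hKexp, ← Real.exp_add]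
        ring_nf

/-- Two integrations over an interval carrying the masses `A` of `h` and `B` of `k` raise one of
the two diagonal entries by a fixed factor, if `r ^ 2 * A * B ≥ 1`. -/
lemma diagonal_growth {u' w' : ℝ → ℝ} (hs : IsSolution h k L r r 1 0 u w)
    (hs' : IsSolution k h L r r 1 0 u' w') (hh : IsWeight h) (hk : IsWeight k) (hr : 0 ≤ r)
    {x y : ℝ} (hx : 0 ≤ x) (hxy : x ≤ y) (hy : y ≤ L)
    (hAB : 1 ≤ r ^ 2 * ((∫ t in x..y, h t) * ∫ t in x..y, k t)) :
    5 / 4 * (u x * u' x) ≤ u y * u' y := by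
  -- one diagonal entry grows if half of the mass of `q` precedes half of the mass of `p`
  have grow (p q : ℝ → ℝ) (U W : ℝ → ℝ) (hS : IsSolution p q L r r 1 0 U W) (hp : IsWeight p)
      (hq : IsWeight q) (s A B : ℝ) (hs1 : x ≤ s) (hs2 : s ≤ y) (hA0 : 0 ≤ A) (hB0 : 0 ≤ B)
      (hB : B ≤ ∫ t in x..s, q t)
      (hA : A ≤ ∫ t in s..y, p t) (hAB : 1 / 4 ≤ r ^ 2 * (A * B)) : 5 / 4 * U x ≤ U y := by
    have h1 := hS.swap.le_fst hq hp hr le_rfl zero_le_one hx hs1 (hs2.trans hy)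
    have h2 := hS.le_fst hp hq hr zero_le_one le_rfl (hx.trans hs1) hs2 hy
    have h3 := hS.fst_mono hp hq hr zero_le_one le_rfl hx hs1 (hs2.trans hy)
    have h4 := hS.fst_nonneg hp hq hr zero_le_one le_rfl ⟨hx, hxy.trans hy⟩
    have h5 := hS.swap.fst_nonneg hq hp hr le_rfl zero_le_one ⟨hx, hxy.trans hy⟩
    have h6 : r * U x * B ≤ W s :=
      (mul_le_mul_of_nonneg_left hB (mul_nonneg hr h4)).trans (by linarith)
    have h7 : r * (r * U x * B) * A ≤ r * W s * (∫ t in s..y, p t) := by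
      have : 0 ≤ W s := (by positivity : 0 ≤ r * U x * B).trans h6
      gcongr
    have h8 : 1 / 4 * U x ≤ r * (r * U x * B) * A := by
      calc _ ≤ r ^ 2 * (A * B) * U x := mul_le_mul_of_nonneg_right hAB h4
        _ = _ := by ring
    linarith
  set A := ∫ t in x..y, h t with hA
  set B := ∫ t in x..y, k t with hB
  have hA0 : 0 ≤ A := intervalIntegral.integral_nonneg hxy fun t _ => hh.nonneg t
  have hB0 : 0 ≤ B := intervalIntegral.integral_nonneg hxy fun t _ => hk.nonneg t
  have hxL : x ∈ Icc 0 L := ⟨hx, hxy.trans hy⟩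
  -- The point `s` halves the mass of `k`. If half of the mass of `h` lies after `s`, then `u`
  -- grows; otherwise half of it lies before `s`, and `u'` grows. The gain is `r ^ 2 (A / 2) (B / 2)
  -- ≥ 1 / 4`. Since either case may occur, only the product of the two entries is controlled.
  obtain ⟨s, ⟨hs1, hs2⟩, hs3⟩ := intermediate_value_Icc hxy
    (intervalIntegral.continuous_primitive hk.intervalIntegrable x).continuousOn
    (show B / 2 ∈ Icc (∫ t in x..x, k t) (∫ t in x..y, k t) from
      ⟨by rw [intervalIntegral.integral_same]; linarith, by linarith⟩)
  simp only at hs3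
  have hsplit (p : ℝ → ℝ) (hp : IsWeight p) := intervalIntegral.integral_add_adjacent_intervals
    (hp.intervalIntegrable x s) (hp.intervalIntegrable s y)
  have h1 := hsplit h hh
  have h2 := hsplit k hk
  have m1 := hs.fst_mono hh hk hr zero_le_one le_rfl hx hxy hy
  have m2 := hs'.fst_mono hk hh hr zero_le_one le_rfl hx hxy hy
  have n1 := hs.fst_nonneg hh hk hr zero_le_one le_rfl hxL
  have n2 := hs'.fst_nonneg hk hh hr zero_le_one le_rfl hxL
  rcases le_total (A / 2) (∫ t in s..y, h t) with hc | hc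
  · have := grow h k u w hs hh hk s (A / 2) (B / 2) hs1 hs2 (by linarith) (by linarith) hs3.ge hc
      (by linarith)
    calc 5 / 4 * (u x * u' x) = (5 / 4 * u x) * u' x := by ring
      _ ≤ _ := mul_le_mul this m2 n2 (n1.trans m1)
  · have := grow k h u' w' hs' hk hh s (B / 2) (A / 2) hs1 hs2 (by linarith) (by linarith)
      (by linarith) (by linarith) (by linarith)
    calc 5 / 4 * (u x * u' x) = u x * (5 / 4 * u' x) := by ring
      _ ≤ _ := mul_le_mul m1 this (by positivity) (n1.trans m1)

end IsSolution

end Positive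

/-! ### Multiplying over coverings, and the greedy covering -/

/-- A function on `[0, L]` which grows at most by the factor `B j` over intervals contained in
`ω j` grows at most by the product of the `B j` over an interval covered by the `ω j`. -/
lemma le_prod_mul_of_cover {ι : Type*} [DecidableEq ι] {L : ℝ} {p : ℝ → ℝ} {ω : ι → Set ℝ}
    {B : ι → ℝ} (hω : ∀ j, (ω j).OrdConnected) (hB : ∀ j, 1 ≤ B j) (hp : 0 ≤ p 0)
    (hstep : ∀ j s t, 0 ≤ s → s ≤ t → t ≤ L → Ioo s t ⊆ ω j → p t ≤ B j * p s) (J : Finset ι)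
    {t : ℝ} (ht : t ∈ Icc 0 L) (hJ : Ioo 0 t ⊆ ⋃ j ∈ J, ω j) :
    p t ≤ (∏ j ∈ J, B j) * p 0 := by
  induction J using Finset.strongInduction generalizing t with
  | H J ih =>
  rcases ht.1.eq_or_lt with rfl | ht0
  · exact le_mul_of_one_le_left hp (Finset.one_le_prod fun j _ => hB j)
  -- Finitely many sets cover a left neighbourhood of `t`, so one of them accumulates at `t` from
  -- the left. Being order-connected, it fills everything from its infimum in `(0, t)` up to `t`; it
  -- has no points in `(0, t)` below that infimum, so the other sets cover the remainder.
  obtain ⟨j, hj, hfreq⟩ : ∃ j ∈ J, ∃ᶠ x in nhdsWithin t (Iio t), x ∈ ω j := by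
    by_contra! hcon
    have h1 : ∀ᶠ x in nhdsWithin t (Iio t), ∀ j ∈ J, x ∉ ω j :=
      (Finset.eventually_all J).2 hcon
    obtain ⟨x, hx1, hx2⟩ := (h1.and (Ioo_mem_nhdsLT ht0)).exists
    obtain ⟨j, hj, hxj⟩ := mem_iUnion₂.1 (hJ hx2)
    exact hx1 j hj hxj
  set Z := ω j ∩ Ioo 0 t with hZ
  have hZne : Z.Nonempty := (hfreq.and_eventually (Ioo_mem_nhdsLT ht0)).exists
  have hZbdd : BddBelow Z := ⟨0, fun x hx => hx.2.1.le⟩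
  have hs0 : 0 ≤ sInf Z := le_csInf hZne fun x hx => hx.2.1.le
  have hst : sInf Z ≤ t := by
    obtain ⟨x, hx⟩ := hZne
    exact (csInf_le hZbdd hx).trans hx.2.2.le
  have h1 : Ioo (sInf Z) t ⊆ ω j := by
    intro x hx
    obtain ⟨y, hy, hyx⟩ := exists_lt_of_csInf_lt hZne hx.1
    obtain ⟨z, hz, hxz⟩ := (hfreq.and_eventually (Ioo_mem_nhdsLT hx.2)).exists
    exact (hω j).out hy.1 hz ⟨hyx.le, hxz.1.le⟩
  have h2 : Ioo 0 (sInf Z) ⊆ ⋃ i ∈ J.erase j, ω i := by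
    intro x hx
    have hxt : x ∈ Ioo 0 t := ⟨hx.1, hx.2.trans_le hst⟩
    obtain ⟨i, hi, hxi⟩ := mem_iUnion₂.1 (hJ hxt)
    refine mem_iUnion₂.2 ⟨i, Finset.mem_erase.2 ⟨?_, hi⟩, hxi⟩
    rintro rfl
    exact (csInf_le hZbdd ⟨hxi, hxt⟩).not_gt hx.2
  calc p t ≤ B j * p (sInf Z) := hstep j _ _ hs0 hst ht.2 h1
    _ ≤ B j * ((∏ i ∈ J.erase j, B i) * p 0) :=
      mul_le_mul_of_nonneg_left (ih _ (Finset.erase_ssubset hj) ⟨hs0, hst.trans ht.2⟩ h2)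
        (zero_le_one.trans (hB j))
    _ = _ := by rw [← mul_assoc, Finset.mul_prod_erase J B hj]

namespace IsSolution

variable {h k : ℝ → ℝ} {L r a b : ℝ} {u w : ℝ → ℝ}

/-- The upper estimate of a solution in terms of a covering. -/
lemma add_le_exp_of_cover (hs : IsSolution h k L r r a b u w) (hh : IsWeight h) (hk : IsWeight k)
    (hL : 0 ≤ L) (hr : 1 ≤ r) (ha : 0 ≤ a) (hb : 0 ≤ b) {n : ℕ} {ω : Fin n → Set ℝ}
    (hω : ∀ j, (ω j).OrdConnected) (hcov : Ioo 0 L ⊆ ⋃ j, ω j) {A B : Fin n → ℝ}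
    (hAL : ∀ j, A j ≤ L) (hBL : ∀ j, B j ≤ L)
    (hA : ∀ j s t, 0 ≤ s → s ≤ t → t ≤ L → Ioo s t ⊆ ω j → ∫ x in s..t, h x ≤ A j)
    (hB : ∀ j s t, 0 ≤ s → s ≤ t → t ≤ L → Ioo s t ⊆ ω j → ∫ x in s..t, k x ≤ B j) :
    u L + w L ≤ Real.exp (4 * r * ∑ j, √(A j * B j)
      + n * (4 * √(2 * L + 1) + 1 + Real.log ((L + 1) * r ^ 2))) * (a + b) := by
  have hlog : 0 ≤ Real.log ((L + 1) * r ^ 2) :=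
    Real.log_nonneg (by nlinarith [one_le_pow₀ hr (n := 2)])
  have key := le_prod_mul_of_cover (p := fun t => u t + w t) (L := L) hω
    (B := fun j => Real.exp
      (4 * r * √(A j * B j) + (4 * √(2 * L + 1) + 1 + Real.log ((L + 1) * r ^ 2))))
    (fun j => Real.one_le_exp (by positivity))
    (by simp only [hs.fst_zero hL, hs.swap.fst_zero hL]; positivity)
    (fun j s t h0 h1 h2 h3 => hs.add_le_exp_sqrt hh hk hr ha hb h0 h1 h2 (hA j s t h0 h1 h2 h3)
      (hB j s t h0 h1 h2 h3) (hAL j) (hBL j))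
    Finset.univ (right_mem_Icc.2 hL) (by simpa using hcov)
  simp only [hs.fst_zero hL, hs.swap.fst_zero hL] at key
  rwa [← Real.exp_sum, Finset.sum_add_distrib, ← Finset.mul_sum, Finset.sum_const,
    Finset.card_univ, Fintype.card_fin, nsmul_eq_mul] at key

/-- The greedy covering: each interval carries a product of masses at most `r⁻²`, and the number of
intervals is controlled by the growth of the diagonal entries. -/
lemma exists_cover {u' w' : ℝ → ℝ} (hs : IsSolution h k L r r 1 0 u w)
    (hs' : IsSolution k h L r r 1 0 u' w') (hh : IsWeight h) (hk : IsWeight k) (hr : 0 < r)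
    (hL : 0 ≤ L) :
    ∃ (n : ℕ) (ω : Fin n → Set ℝ), (∀ j, ∃ x y, 0 ≤ x ∧ x ≤ y ∧ y ≤ L ∧ ω j = Ico x y ∧
      r ^ 2 * ((∫ t in x..y, h t) * ∫ t in x..y, k t) ≤ 1) ∧ Ico 0 L ⊆ (⋃ j, ω j) ∧
      (5 / 4 : ℝ) ^ n ≤ 5 / 4 * (u L * u' L) := by
  set Good : ℕ → ℝ → Prop := fun m z => ∃ ω : Fin m → Set ℝ,
    (∀ j, ∃ x y, 0 ≤ x ∧ x ≤ y ∧ y ≤ L ∧ ω j = Ico x y ∧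
      r ^ 2 * ((∫ t in x..y, h t) * ∫ t in x..y, k t) ≤ 1) ∧ Ico 0 z ⊆ ⋃ j, ω j with hGood
  have extend (m : ℕ) (z y : ℝ) (hz : 0 ≤ z) (hzy : z ≤ y) (hy : y ≤ L)
      (hm : r ^ 2 * ((∫ t in z..y, h t) * ∫ t in z..y, k t) ≤ 1) (hg : Good m z) :
      Good (m + 1) y := by
    obtain ⟨ω, h1, h2⟩ := hg
    refine ⟨Fin.snoc (α := fun _ => Set ℝ) ω (Ico z y), fun j => ?_, fun t ht => ?_⟩
    · refine Fin.lastCases ?_ (fun i => ?_) j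
      · exact ⟨z, y, hz, hzy, hy, by simp, hm⟩
      · simpa using h1 i
    · rcases lt_or_ge t z with htz | htz
      · obtain ⟨i, hi⟩ := mem_iUnion.1 (h2 ⟨ht.1, htz⟩)
        exact mem_iUnion.2 ⟨i.castSucc, by simpa using hi⟩
      · exact mem_iUnion.2 ⟨Fin.last m, by simpa using ⟨htz, ht.2⟩⟩
  have mono {z : ℝ} (hz : 0 ≤ z) (hzL : z ≤ L) : u z * u' z ≤ u L * u' L :=
    mul_le_mul (hs.fst_mono hh hk hr.le zero_le_one le_rfl hz hzL le_rfl)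
      (hs'.fst_mono hk hh hr.le zero_le_one le_rfl hz hzL le_rfl)
      (hs'.fst_nonneg hk hh hr.le zero_le_one le_rfl ⟨hz, hzL⟩)
      (hs.fst_nonneg hh hk hr.le zero_le_one le_rfl (right_mem_Icc.2 hL))
  -- Only the last interval may be incomplete and contribute no growth; hence the factor `5 / 4` in
  -- the conclusion.
  suffices H : ∃ m z, 0 ≤ z ∧ z ≤ L ∧ Good m z ∧ (5 / 4 : ℝ) ^ m ≤ u z * u' z ∧
      r ^ 2 * ((∫ t in z..L, h t) * ∫ t in z..L, k t) ≤ 1 by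
    obtain ⟨m, z, hz, hzL, hg, hm, hlast⟩ := H
    obtain ⟨ω, h1, h2⟩ := extend m z L hz hzL le_rfl hlast hg
    refine ⟨m + 1, ω, h1, h2, ?_⟩
    rw [pow_succ']
    exact mul_le_mul_of_nonneg_left (hm.trans (mono hz hzL)) (by norm_num)
  -- Otherwise the greedy choice never stops, and `u * u'` exceeds every power of `5 / 4` although
  -- it is bounded by its value at `L`.
  by_contra! hcon
  have all (m : ℕ) : ∃ z, 0 ≤ z ∧ z ≤ L ∧ Good m z ∧ (5 / 4 : ℝ) ^ m ≤ u z * u' z := by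
    induction m with
    | zero =>
      refine ⟨0, le_rfl, hL, ⟨Fin.elim0, fun j => j.elim0, by simp⟩, ?_⟩
      simp [hs.fst_zero hL, hs'.fst_zero hL]
    | succ m ih =>
      obtain ⟨z, hz, hzL, hg, hm⟩ := ih
      have hc := hcon m z hz hzL hg hm
      set Φ : ℝ → ℝ := fun y => r ^ 2 * ((∫ t in z..y, h t) * ∫ t in z..y, k t) with hΦ
      have hΦc : Continuous Φ := by
        have h1 := intervalIntegral.continuous_primitive hh.intervalIntegrable z
        have h2 := intervalIntegral.continuous_primitive hk.intervalIntegrable z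
        fun_prop
      -- Equality `Φ y = 1` serves twice: `≤ 1` for the covering and `≥ 1` for the growth.
      obtain ⟨y, ⟨hy1, hy2⟩, hy3⟩ := intermediate_value_Icc hzL hΦc.continuousOn
        (show (1 : ℝ) ∈ Icc (Φ z) (Φ L) from ⟨by simp [Φ], hc.le⟩)
      refine ⟨y, hz.trans hy1, hy2, extend m z y hz hy1 hy2 hy3.le hg, ?_⟩
      have := hs.diagonal_growth hs' hh hk hr.le hz hy1 hy2 hy3.ge
      calc (5 / 4 : ℝ) ^ (m + 1) = 5 / 4 * (5 / 4) ^ m := pow_succ' _ _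
        _ ≤ 5 / 4 * (u z * u' z) := by gcongr
        _ ≤ _ := this
  obtain ⟨m, hm⟩ := pow_unbounded_of_one_lt (u L * u' L) (by norm_num : (1 : ℝ) < 5 / 4)
  obtain ⟨z, hz, hzL, -, hm'⟩ := all m
  exact (hm.trans_le (hm'.trans (mono hz hzL))).false

end IsSolution

/-! ### Order of growth and exponential bounds -/

lemma growthOrder_nonneg (f : ℂ → ℂ) : 0 ≤ growthOrder f := by
  refine le_limsup_of_frequently_le (Eventually.frequently ?_)
  have h := tendsto_norm_cobounded_atTop (E := ℂ)
  filter_upwards [h.eventually_ge_atTop 1] with z hz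
  exact_mod_cast div_nonneg Real.posLog_nonneg (Real.log_nonneg hz)

/-- The constant and the logarithm are absorbed by `‖z‖ ^ (e - d)` for every `e > d`. -/
lemma growthOrder_le_of_norm_le {f : ℂ → ℂ} {d C : ℝ}
    (hf : ∀ᶠ z in Bornology.cobounded ℂ, ‖f z‖ ≤ Real.exp (C * ‖z‖ ^ d * (1 + Real.log ‖z‖)))
    (hd : 0 ≤ d) : growthOrder f ≤ d := by
  refine EReal.le_of_forall_lt_iff_le.1 fun e he => ?_
  have hde : d < e := by exact_mod_cast he
  have hnorm := tendsto_norm_cobounded_atTop (E := ℂ)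
  have hev : ∀ᶠ r : ℝ in atTop, C * r ^ d * (1 + Real.log r) ≤ r ^ e := by
    have h1 : (fun r : ℝ => C * r ^ d * (1 + Real.log r)) =o[atTop] fun r => r ^ e := by
      have h2 : (fun r : ℝ => 1 + Real.log r) =o[atTop] fun r => r ^ (e - d) :=
        ((Asymptotics.isLittleO_const_left.2 (Or.inr (by
          simpa using tendsto_norm_atTop_atTop.comp (tendsto_rpow_atTop (sub_pos.2 hde)))))).add
          (isLittleO_log_rpow_atTop (sub_pos.2 hde))
      have h3 := ((Asymptotics.isBigO_refl (fun r : ℝ => r ^ d) atTop).const_mul_left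
        C).mul_isLittleO h2
      refine h3.congr' EventuallyEq.rfl ?_
      filter_upwards [eventually_gt_atTop 0] with r hr
      rw [← Real.rpow_add hr, add_sub_cancel]
    filter_upwards [h1.bound one_pos, eventually_gt_atTop 0] with r hr h0
    rw [one_mul, Real.norm_of_nonneg (Real.rpow_nonneg h0.le e)] at hr
    exact (le_abs_self _).trans hr
  refine limsup_le_of_le (h := ?_)
  filter_upwards [hf, hnorm.eventually hev, hnorm.eventually_gt_atTop 1] with z h1 h2 h3
  have hlog := Real.log_pos h3
  rw [EReal.coe_le_coe_iff, div_le_iff₀ hlog]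
  have h4 : Real.posLog ‖f z‖ ≤ ‖z‖ ^ e := by
    refine (Real.posLog_le_posLog (norm_nonneg _) (h1.trans (Real.exp_le_exp.2 h2))).trans ?_
    rw [Real.posLog_apply, Real.log_exp]
    exact max_le (by positivity) le_rfl
  refine (Real.posLog_le_posLog Real.posLog_nonneg h4).trans ?_
  rw [Real.posLog_apply, Real.log_rpow (by linarith)]
  exact max_le (mul_nonneg (hd.trans hde.le) hlog.le) le_rfl

lemma norm_le_exp_of_growthOrder_lt {f : ℂ → ℂ} {d : ℝ} (hf : growthOrder f < d) :
    ∀ᶠ z in Bornology.cobounded ℂ, ‖f z‖ ≤ Real.exp (‖z‖ ^ d) := by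
  have hnorm := tendsto_norm_cobounded_atTop (E := ℂ)
  filter_upwards [eventually_lt_of_limsup_lt hf, hnorm.eventually_gt_atTop 1] with z h1 h2
  have hlog := Real.log_pos h2
  rw [EReal.coe_lt_coe_iff, div_lt_iff₀ hlog, ← Real.log_rpow (by linarith)] at h1
  have hpow : 0 < ‖z‖ ^ d := Real.rpow_pos_of_pos (by linarith) d
  have h3 : Real.posLog ‖f z‖ ≤ ‖z‖ ^ d := by
    rcases (Real.posLog_nonneg (x := ‖f z‖)).eq_or_lt with h | h
    · rw [← h]; exact hpow.le
    · exact ((Real.log_lt_log_iff h hpow).1 ((le_max_right _ _).trans_lt h1)).le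
  refine le_trans ?_ (Real.exp_le_exp.2 h3)
  exact (Real.le_exp_log _).trans (Real.exp_le_exp.2 (le_max_right _ _))

/-! ### Integrated equations and the imaginary axis -/

/-- The fundamental theorem of calculus for complex valued absolutely continuous functions. -/
lemma AbsolutelyContinuousOnInterval.eq_add_integral_complex {φ F : ℝ → ℂ} {L : ℝ}
    (hφ : AbsolutelyContinuousOnInterval φ 0 L)
    (hF : ∀ x ∈ Icc 0 L, IntervalIntegrable F volume 0 x)
    (hd : ∀ᵐ x ∂volume.restrict (Icc 0 L), HasDerivAt φ (F x) x) {x : ℝ} (hx : x ∈ Icc 0 L) :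
    φ x = φ 0 + ∫ t in 0..x, F t := by
  have hL : 0 ≤ L := hx.1.trans hx.2
  have part (T : ℂ →L[ℝ] ℝ) (hT : ∀ c, |T c| ≤ ‖c‖) : T (φ x) = T (φ 0) + T (∫ t in 0..x, F t) := by
    have hac : AbsolutelyContinuousOnInterval (fun t => T (φ t)) 0 L := by
      rw [absolutelyContinuousOnInterval_iff] at hφ ⊢
      intro ε hε
      obtain ⟨δ, hδ, h⟩ := hφ ε hε
      refine ⟨δ, hδ, fun E hE hsum => (Finset.sum_le_sum fun i _ => ?_).trans_lt (h E hE hsum)⟩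
      rw [Real.dist_eq, ← map_sub, dist_eq_norm]
      exact hT _
    have hac' := hac.mono (c := 0) (d := x)
      (by rw [uIcc_of_le hx.1, uIcc_of_le hL]; exact Icc_subset_Icc le_rfl hx.2)
    have h1 := hac'.integral_deriv_eq_sub
    rw [← T.intervalIntegral_comp_comm (hF x hx)]
    have h2 : ∫ t in 0..x, deriv (fun t => T (φ t)) t = ∫ t in 0..x, T (F t) := by
      refine intervalIntegral.integral_congr_ae ?_
      rw [ae_restrict_iff' measurableSet_Icc] at hd
      filter_upwards [hd] with t ht ht'
      rw [uIoc_of_le hx.1] at ht'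
      exact (T.hasFDerivAt.comp_hasDerivAt t (ht ⟨ht'.1.le, ht'.2.trans hx.2⟩)).deriv
    linarith
  apply Complex.ext
  · simpa using part Complex.reCLM Complex.abs_re_le_norm
  · simpa using part Complex.imCLM Complex.abs_im_le_norm

/-- For `z = i r` the factor `i` couples the real part of `f` only to the imaginary part of `g`; the
sign in `-(g x).im` makes both coefficients equal to `r`. -/
lemma IsSolution.real_of_imaginary {h k : ℝ → ℝ} {L r : ℝ} {f g : ℝ → ℂ} (hh : IsWeight h)
    (hk : IsWeight k)
    (hs : IsSolution h k L (Complex.I * r) (-(Complex.I * r)) 1 0 f g) :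
    IsSolution h k L r r 1 0 (fun x => (f x).re) (fun x => -(g x).im) := by
  have hsub {x : ℝ} (hx : x ∈ Icc 0 L) : uIcc 0 x ⊆ Icc 0 L := by
    rw [uIcc_of_le hx.1]; exact Icc_subset_Icc le_rfl hx.2
  refine ⟨Complex.continuous_re.comp_continuousOn hs.continuousOn_fst,
    (Complex.continuous_im.comp_continuousOn hs.continuousOn_snd).neg, fun x hx => ?_,
    fun x hx => ?_⟩
  · have := Complex.imCLM.intervalIntegral_comp_comm
      (hh.intervalIntegrable_smul (hs.continuousOn_snd.mono (hsub hx)))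
    simp only [Complex.imCLM_apply, Complex.smul_im] at this
    simp only [hs.fst_eq x hx, smul_neg, intervalIntegral.integral_neg]
    rw [this]
    simp
  · have := Complex.reCLM.intervalIntegral_comp_comm
      (hk.intervalIntegrable_smul (hs.continuousOn_fst.mono (hsub hx)))
    simp only [Complex.reCLM_apply, Complex.smul_re] at this
    simp only [hs.snd_eq x hx]
    rw [this]
    simp

/-- A family of solutions of `f' = z h g`, `g' = -z k f`, `f 0 = 1`, `g 0 = 0` is majorized by
the Neumann sums, which are attained on the imaginary axis. -/
lemma neumannSum_majorant {h k : ℝ → ℝ} {L : ℝ} {f g : ℂ → ℝ → ℂ} (hL : 0 ≤ L) (hh : IsWeight h)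
    (hk : IsWeight k) (hs : ∀ z, IsSolution h k L z (-z) 1 0 (f z) (g z)) :
    (∀ z, ‖f z L‖ ≤ neumannSum h k ‖z‖ 1 0 L) ∧ (∀ z, ‖g z L‖ ≤ neumannSum k h ‖z‖ 0 1 L) ∧
    (∀ r : ℝ, neumannSum h k r 1 0 L ≤ ‖f (Complex.I * r) L‖) ∧
    (∀ r : ℝ, neumannSum k h r 0 1 L ≤ ‖g (Complex.I * r) L‖) := by
  have hmem : L ∈ Icc 0 L := right_mem_Icc.2 hL
  refine ⟨fun z => ?_, fun z => ?_, fun r => ?_, fun r => ?_⟩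
  · simpa using (hs z).norm_le_neumannSum hh hk le_rfl (norm_neg z).le hmem
  · simpa using (hs z).swap.norm_le_neumannSum hk hh (norm_neg z).le le_rfl hmem
  · rw [← ((hs _).real_of_imaginary hh hk).eq_neumannSum hh hk hmem]
    exact Complex.re_le_norm _
  · rw [← ((hs _).real_of_imaginary hh hk).swap.eq_neumannSum hk hh hmem]
    exact (neg_le_abs _).trans (Complex.abs_im_le_norm _)

/-! ### From the canonical system to the off-diagonal system -/

namespace CanonicalSystem

variable {S : CanonicalSystem}

/-- The set `X` need not be Borel: measurability of its indicator is inherited from `m`, a diagonal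
entry of the Hamiltonian in the applications. -/
lemma isWeight_indicator {X : Set ℝ} {L : ℝ} {m : ℝ → ℝ} (hX : X ⊆ Ioo 0 L)
    (hm : IntegrableOn m (Icc 0 L))
    (h : ∀ᵐ x ∂volume.restrict (Icc 0 L), x ∈ Ioo 0 L → m x = X.indicator 1 x) :
    IsWeight (X.indicator 1) := by
  refine ⟨?_, fun x => indicator_nonneg (fun _ _ => zero_le_one) x,
    fun x => indicator_le_self' (fun _ _ => zero_le_one) x⟩
  have h1 : AEStronglyMeasurable ((Ioo 0 L).indicator m) volume :=
    (aestronglyMeasurable_indicator_iff measurableSet_Ioo).2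
      (hm.mono_set Ioo_subset_Icc_self).aestronglyMeasurable
  refine h1.congr ?_
  rw [ae_restrict_iff' measurableSet_Icc] at h
  filter_upwards [h] with x hx
  by_cases hxL : x ∈ Ioo 0 L
  · rw [indicator_of_mem hxL, hx (Ioo_subset_Icc_self hxL) hxL]
  · rw [indicator_of_notMem hxL, indicator_of_notMem (fun h => hxL (hX h))]

lemma H₁_ne_H₂ : H₁ ≠ H₂ := fun h => by
  simpa [H₁, H₂] using congrFun (congrFun h 0) 0

lemma X₁_subset (S : CanonicalSystem) : S.X₁ ⊆ Ioo 0 S.L := fun _ hx => hx.1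

lemma X₂_subset (S : CanonicalSystem) : S.X₂ ⊆ Ioo 0 S.L := fun _ hx => hx.1

lemma isWeight_X₁
    (hS : ∀ᵐ x ∂volume.restrict (Icc 0 S.L), S.H x = H₁ ∨ S.H x = H₂) :
    IsWeight (S.X₁.indicator 1) := by
  refine isWeight_indicator S.X₁_subset (S.integrable 0 0) ?_
  filter_upwards [hS] with x hx hxL
  rcases hx with hx | hx
  · rw [indicator_of_mem (show x ∈ S.X₁ from ⟨hxL, hx⟩), hx]; simp [H₁]
  · rw [indicator_of_notMem (fun h : x ∈ S.X₁ => H₁_ne_H₂ (h.2.symm.trans hx)), hx]; simp [H₂]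

lemma isWeight_X₂
    (hS : ∀ᵐ x ∂volume.restrict (Icc 0 S.L), S.H x = H₁ ∨ S.H x = H₂) :
    IsWeight (S.X₂.indicator 1) := by
  refine isWeight_indicator S.X₂_subset (S.integrable 1 1) ?_
  filter_upwards [hS] with x hx hxL
  rcases hx with hx | hx
  · rw [indicator_of_notMem (fun h : x ∈ S.X₂ => H₁_ne_H₂ (hx.symm.trans h.2)), hx]; simp [H₁]
  · rw [indicator_of_mem (show x ∈ S.X₂ from ⟨hxL, hx⟩), hx]; simp [H₂]

/-- On `X₁` the equation moves only the second row of `M`, on `X₂` only the first; absolute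
continuity allows integration of these a.e. identities. -/
lemma IsMonodromy.isSolution
    (hS : ∀ᵐ x ∂volume.restrict (Icc 0 S.L), S.H x = H₁ ∨ S.H x = H₂)
    {M : ℝ → ℂ → Matrix (Fin 2) (Fin 2) ℂ} (hM : S.IsMonodromy M)
    (z : ℂ) (c : Fin 2) :
    IsSolution (S.X₂.indicator 1) (S.X₁.indicator 1) S.L z (-z)
      ((1 : Matrix (Fin 2) (Fin 2) ℂ) 0 c) ((1 : Matrix (Fin 2) (Fin 2) ℂ) 1 c)
      (fun x => M x z 0 c) (fun x => M x z 1 c) := by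
  have hL := S.L_pos.le
  have hcont (i : Fin 2) : ContinuousOn (fun x => M x z i c) (Icc 0 S.L) := by
    simpa [uIcc_of_le hL] using (hM.absolutelyContinuous z i c).continuousOn
  have hsub {x : ℝ} (hx : x ∈ Icc 0 S.L) : uIcc 0 x ⊆ Icc 0 S.L := by
    rw [uIcc_of_le hx.1]; exact Icc_subset_Icc le_rfl hx.2
  have hIoo : ∀ᵐ x ∂volume.restrict (Icc 0 S.L), x ∈ Ioo 0 S.L := by
    rw [← Measure.restrict_congr_set Ioo_ae_eq_Icc]; exact ae_restrict_mem measurableSet_Ioo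
  have hder : ∀ᵐ x ∂volume.restrict (Icc 0 S.L),
      HasDerivAt (fun t => M t z 0 c) (z * (S.X₂.indicator (1 : ℝ → ℝ) x • M x z 1 c)) x ∧
      HasDerivAt (fun t => M t z 1 c) (-z * (S.X₁.indicator (1 : ℝ → ℝ) x • M x z 0 c)) x := by
    filter_upwards [hM.equation z, hS, hIoo] with x ⟨M', hM', hE⟩ hx hxL
    have e0 := congrFun (congrFun hE 0) c
    have e1 := congrFun (congrFun hE 1) c
    rcases hx with hx | hx
    · have hx1 : x ∈ S.X₁ := ⟨hxL, hx⟩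
      have hx2 : x ∉ S.X₂ := fun h => H₁_ne_H₂ (hx.symm.trans h.2)
      simp [J, hx, H₁, Matrix.mul_apply, Fin.sum_univ_two] at e0 e1
      rw [indicator_of_mem hx1, indicator_of_notMem hx2]
      constructor
      · simpa [e1] using hM' 0 c
      · simpa [← e0] using hM' 1 c
    · have hx2 : x ∈ S.X₂ := ⟨hxL, hx⟩
      have hx1 : x ∉ S.X₁ := fun h => H₁_ne_H₂ (h.2.symm.trans hx)
      simp [J, hx, H₂, Matrix.mul_apply, Fin.sum_univ_two] at e0 e1
      rw [indicator_of_mem hx2, indicator_of_notMem hx1]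
      constructor
      · simpa [← e1] using hM' 0 c
      · simpa [e0] using hM' 1 c
  refine ⟨hcont 0, hcont 1, fun x hx => ?_, fun x hx => ?_⟩
  · rw [(hM.absolutelyContinuous z 0 c).eq_add_integral_complex
      (fun y hy => ((isWeight_X₂ hS).intervalIntegrable_smul ((hcont 1).mono (hsub hy))).const_mul z)
      (hder.mono fun _ h => h.1) hx, intervalIntegral.integral_const_mul, hM.initial z]
  · rw [(hM.absolutelyContinuous z 1 c).eq_add_integral_complex
      (fun y hy =>
        ((isWeight_X₁ hS).intervalIntegrable_smul ((hcont 0).mono (hsub hy))).const_mul (-z))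
      (hder.mono fun _ h => h.2) hx, intervalIntegral.integral_const_mul, hM.initial z]

lemma integral_indicator_eq {X : Set ℝ} (hX : IsWeight (X.indicator 1)) {s t : ℝ} (hst : s ≤ t) :
    ∫ x in s..t, X.indicator (1 : ℝ → ℝ) x = volume.real (Ioo s t ∩ X) := by
  have hnull : NullMeasurableSet X volume := by
    have := hX.aestronglyMeasurable.aemeasurable.nullMeasurable (measurableSet_singleton (1 : ℝ))
    have e : X.indicator (1 : ℝ → ℝ) ⁻¹' {1} = X := by
      ext x
      by_cases hx : x ∈ X <;> simp [hx]
    rwa [e] at this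
  rw [intervalIntegral.integral_of_le hst, integral_Ioc_eq_integral_Ioo,
    integral_indicator₀ (hnull.mono_ac Measure.restrict_le_self.absolutelyContinuous)]
  simp [Measure.real, Measure.restrict_apply₀
    (hnull.mono_ac Measure.restrict_le_self.absolutelyContinuous), inter_comm]

end CanonicalSystem

/-- At most two moves, along a row or a column of the fundamental matrix, lead from the given entry
to either diagonal entry. Each move costs a factor `r * x` and possibly the initial value `1`. -/
lemma neumannSum_diagonal_le {p q : ℝ → ℝ} (hp : IsWeight p) (hq : IsWeight q) {r x G : ℝ}
    (hr : 0 ≤ r) (hx : 0 ≤ x)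
    (hG : neumannSum p q r 1 0 x ≤ G ∨ neumannSum p q r 0 1 x ≤ G) :
    neumannSum p q r 1 0 x ≤ (1 + r * x) ^ 2 * (1 + G) ∧
    neumannSum q p r 1 0 x ≤ (1 + r * x) ^ 2 * (1 + G) := by
  have a1 := neumannSum_le hp hq hr zero_le_one le_rfl hx
  have a2 := neumannSum_le_swap hq hp hr zero_le_one le_rfl hx
  have a3 := neumannSum_le hp hq hr le_rfl zero_le_one hx
  have n1 := neumannSum_nonneg hp hq hr zero_le_one le_rfl hx
  have n2 := neumannSum_nonneg hp hq hr le_rfl zero_le_one hx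
  have ht : 0 ≤ r * x := mul_nonneg hr hx
  rcases hG with h | h
  · have hG0 := n1.trans h
    have h1 := mul_le_mul_of_nonneg_left a3 ht
    have h2 := mul_le_mul_of_nonneg_left h (mul_nonneg ht ht)
    have h3 := mul_nonneg ht hG0
    constructor <;> nlinarith [mul_nonneg ht h3]
  · have hG0 := n2.trans h
    have h1 := mul_le_mul_of_nonneg_left h ht
    have h3 := mul_nonneg ht hG0
    constructor <;> nlinarith [mul_nonneg ht h3]

/-! ### Coverings versus growth -/

section Cover

variable {X Y : Set ℝ} {L : ℝ}

/-- Condition (A), multiplied by `r`, and condition (B), multiplied by the price `O(1 + log r)` of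
one interval, both fit into `r ^ d (1 + log r)`. -/
lemma IsSolution.neumannSum_le_exp_of_cover {a b r C d : ℝ} {u w : ℝ → ℝ}
    (hs : IsSolution (X.indicator 1) (Y.indicator 1) L r r a b u w)
    (hX : IsWeight (X.indicator 1)) (hY : IsWeight (Y.indicator 1)) (hXL : X ⊆ Ioo 0 L)
    (hYL : Y ⊆ Ioo 0 L) (hL : 0 ≤ L) (hr : 1 ≤ r) (ha : 0 ≤ a) (hb : 0 ≤ b) (hab : a + b = 1)
    {n : ℕ} {ω : Fin n → Set ℝ} (hω : ∀ j, (ω j).OrdConnected) (hcov : Ioo 0 L ⊆ ⋃ j, ω j)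
    (hsum : ∑ j, √(volume.real (ω j ∩ X) * volume.real (ω j ∩ Y)) ≤ C * r ^ (d - 1))
    (hn : (n : ℝ) ≤ C * r ^ d) :
    neumannSum (X.indicator 1) (Y.indicator 1) r a b L ≤
      Real.exp (C * (4 * √(2 * L + 1) + 7 + Real.log (L + 1)) * r ^ d * (1 + Real.log r)) := by
  have hr0 : 0 < r := by linarith
  have hlogr := Real.log_nonneg hr
  have hlogL := Real.log_nonneg (by linarith : 1 ≤ L + 1)
  have hfin {Z : Set ℝ} (hZ : Z ⊆ Ioo 0 L) (W : Set ℝ) : volume (W ∩ Z) ≠ ⊤ :=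
    measure_ne_top_of_subset (inter_subset_right.trans hZ) (by simp)
  have hle {Z : Set ℝ} (hZ : Z ⊆ Ioo 0 L) (W : Set ℝ) : volume.real (W ∩ Z) ≤ L := by
    have := measureReal_mono (μ := volume) ((inter_subset_right (s := W)).trans hZ) (by simp)
    simpa [hL] using this
  have hint {Z : Set ℝ} (hZ : Z ⊆ Ioo 0 L) (hZw : IsWeight (Z.indicator 1)) (j : Fin n) (s t : ℝ)
      (hst : s ≤ t) (h : Ioo s t ⊆ ω j) :
      ∫ x in s..t, Z.indicator (1 : ℝ → ℝ) x ≤ volume.real (ω j ∩ Z) := by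
    rw [CanonicalSystem.integral_indicator_eq hZw hst]
    exact measureReal_mono (inter_subset_inter_left Z h) (hfin hZ _)
  have key := hs.add_le_exp_of_cover hX hY hL hr ha hb hω hcov
    (A := fun j => volume.real (ω j ∩ X)) (B := fun j => volume.real (ω j ∩ Y))
    (fun j => hle hXL _) (fun j => hle hYL _) (fun j s t _ h1 _ h2 => hint hXL hX j s t h1 h2)
    (fun j s t _ h1 _ h2 => hint hYL hY j s t h1 h2)
  rw [hab, mul_one, hs.eq_neumannSum hX hY (right_mem_Icc.2 hL)] at key
  have hw := hs.swap.fst_nonneg hY hX hr0.le hb ha (right_mem_Icc.2 hL)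
  refine (le_add_of_nonneg_right hw).trans (key.trans (Real.exp_le_exp.2 ?_))
  have hCd : 0 ≤ C * r ^ d := n.cast_nonneg.trans hn
  have e1 : 4 * r * ∑ j, √(volume.real (ω j ∩ X) * volume.real (ω j ∩ Y)) ≤ 4 * (C * r ^ d) := by
    calc _ ≤ 4 * r * (C * r ^ (d - 1)) := by gcongr
      _ = 4 * (C * (r ^ (d - 1) * r)) := by ring
      _ = _ := by rw [← Real.rpow_add_one hr0.ne', sub_add_cancel]
  have e2 : Real.log ((L + 1) * r ^ 2) = Real.log (L + 1) + 2 * Real.log r := by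
    rw [Real.log_mul (by linarith) (by positivity), Real.log_pow]
    norm_num
  rw [e2]
  have e3 : (n : ℝ) * (4 * √(2 * L + 1) + 1 + (Real.log (L + 1) + 2 * Real.log r))
      ≤ C * r ^ d * (4 * √(2 * L + 1) + 1 + (Real.log (L + 1) + 2 * Real.log r)) := by gcongr
  -- This is exactly the slack left by the constant `7` in the claimed exponent.
  have e4 : 0 ≤ C * r ^ d * ((4 * √(2 * L + 1) + 5 + Real.log (L + 1)) * Real.log r + 2) := by
    positivity
  linarith

/-- If the diagonal entries grow at most like `exp (r ^ d)`, then the greedy coverings have the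
exponent `d`. -/
lemma exists_cover_of_growth {d : ℝ} (hX : IsWeight (X.indicator 1))
    (hY : IsWeight (Y.indicator 1)) (hL : 0 ≤ L) (hd : 0 < d)
    (hsol : ∀ r : ℝ, ∃ u w : ℝ → ℝ, IsSolution (X.indicator 1) (Y.indicator 1) L r r 1 0 u w)
    (hsol' : ∀ r : ℝ, ∃ u w : ℝ → ℝ, IsSolution (Y.indicator 1) (X.indicator 1) L r r 1 0 u w)
    (hgrow : ∀ᶠ r in atTop,
      neumannSum (X.indicator 1) (Y.indicator 1) r 1 0 L
        ≤ (1 + r * L) ^ 2 * (1 + Real.exp (r ^ d)) ∧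
      neumannSum (Y.indicator 1) (X.indicator 1) r 1 0 L
        ≤ (1 + r * L) ^ 2 * (1 + Real.exp (r ^ d))) :
    ∃ C : ℝ, 0 < C ∧ ∀ᶠ R : ℝ in atTop,
      ∃ (n : ℕ) (ω : Fin n → Set ℝ), (∀ j, (ω j).OrdConnected) ∧ Ioo 0 L ⊆ ⋃ j, ω j ∧
        ∑ j, √(volume.real (ω j ∩ X) * volume.real (ω j ∩ Y)) ≤ C * R ^ (d - 1) ∧
        (n : ℝ) ≤ C * R ^ d := by
  have hlogL := Real.log_nonneg (by linarith : 1 ≤ 1 + L)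
  have hc : 0 < Real.log (5 / 4) := Real.log_pos (by norm_num)
  -- Here `log (5 / 4)` pays for the incomplete interval, and the rest is twice the bound for `log Q
  -- / r ^ d`, once for each diagonal entry.
  set D := Real.log (5 / 4) + (4 * (Real.log (1 + L) + 1 / d) + 2 * (Real.log 2 + 1)) with hD
  have hlog2 := Real.log_pos one_lt_two
  refine ⟨D / Real.log (5 / 4), by positivity, ?_⟩
  filter_upwards [hgrow, eventually_ge_atTop 1] with r hr hr1
  have hr0 : 0 < r := by linarith
  obtain ⟨u, w, hs⟩ := hsol r
  obtain ⟨u', w', hs'⟩ := hsol' r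
  obtain ⟨n, ω, hω, hcov, hn⟩ := hs.exists_cover hs' hX hY hr0 hL
  have hmem := right_mem_Icc.2 hL
  have hnn := hs'.fst_nonneg hY hX hr0.le zero_le_one le_rfl hmem
  rw [hs.eq_neumannSum hX hY hmem] at hn
  rw [hs'.eq_neumannSum hY hX hmem] at hn hnn
  have hpow : 1 ≤ r ^ d := Real.one_le_rpow hr1 hd.le
  set Q := (1 + r * L) ^ 2 * (1 + Real.exp (r ^ d)) with hQ
  have hQ0 : 0 < Q := by positivity
  have hlogQ : Real.log Q ≤ (2 * (Real.log (1 + L) + 1 / d) + (Real.log 2 + 1)) * r ^ d := by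
    have h1 : Q ≤ ((1 + L) * r) ^ 2 * (2 * Real.exp (r ^ d)) := by
      rw [hQ]
      gcongr
      · nlinarith
      · linarith [Real.one_le_exp (by positivity : 0 ≤ r ^ d)]
    have h2 : Real.log Q ≤ 2 * (Real.log (1 + L) + Real.log r) + (Real.log 2 + r ^ d) := by
      refine (Real.log_le_log hQ0 h1).trans_eq ?_
      rw [Real.log_mul (by positivity) (by positivity), Real.log_pow,
        Real.log_mul (by positivity) (by positivity), Real.log_mul (by positivity) (by positivity),
        Real.log_exp, Nat.cast_ofNat]
    have h3 : Real.log r ≤ 1 / d * r ^ d := by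
      have := Real.log_le_rpow_div hr0.le hd
      rw [one_div, inv_mul_eq_div]; exact this
    have h4 := le_mul_of_one_le_right hlogL hpow
    have h5 := le_mul_of_one_le_right hlog2.le hpow
    linarith
  have hnC : (n : ℝ) ≤ D / Real.log (5 / 4) * r ^ d := by
    have h1 : (5 / 4 : ℝ) ^ n ≤ 5 / 4 * (Q * Q) :=
      hn.trans (mul_le_mul_of_nonneg_left (mul_le_mul hr.1 hr.2 hnn hQ0.le) (by norm_num))
    have h2 := Real.log_le_log (by positivity) h1
    rw [Real.log_pow, Real.log_mul (by norm_num) (by positivity),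
      Real.log_mul hQ0.ne' hQ0.ne'] at h2
    rw [div_mul_eq_mul_div, le_div_iff₀ hc]
    have h3 := le_mul_of_one_le_right hc.le hpow
    rw [hD]
    linarith
  refine ⟨n, ω, fun j => ?_, Ioo_subset_Ico_self.trans hcov, ?_, hnC⟩
  · obtain ⟨x, y, -, -, -, h, -⟩ := hω j
    rw [h]; exact ordConnected_Ico
  · have hterm (j : Fin n) : √(volume.real (ω j ∩ X) * volume.real (ω j ∩ Y)) ≤ 1 / r := by
      obtain ⟨x, y, -, hxy, -, h, hm⟩ := hω j
      have e (Z : Set ℝ) : volume.real (Ico x y ∩ Z) = volume.real (Ioo x y ∩ Z) :=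
        measureReal_congr (Ioo_ae_eq_Ico.symm.inter (ae_eq_refl Z))
      rw [CanonicalSystem.integral_indicator_eq hX hxy,
        CanonicalSystem.integral_indicator_eq hY hxy] at hm
      rw [h, e, e, Real.sqrt_le_left (by positivity), one_div, inv_pow, ← one_div,
        le_div_iff₀ (by positivity)]
      linarith
    calc _ ≤ ∑ _j : Fin n, 1 / r := Finset.sum_le_sum fun j _ => hterm j
      _ = n * (1 / r) := by simp
      _ ≤ D / Real.log (5 / 4) * r ^ d * (1 / r) := by gcongr
      _ = _ := by rw [Real.rpow_sub_one hr0.ne']; ring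

end Cover

/-! ### The order as an infimum of covering exponents -/

namespace CanonicalSystem

/-- The order of a function with a majorant which is attained on every circle and is one of the
Neumann sums of the system. -/
lemma growthOrder_eq_of_majorant (S : CanonicalSystem) {X Y : Set ℝ}
    (hXY : (X = S.X₁ ∧ Y = S.X₂) ∨ (X = S.X₂ ∧ Y = S.X₁))
    (hX : IsWeight (X.indicator 1)) (hY : IsWeight (Y.indicator 1))
    (hsol : ∀ r : ℝ, ∃ u w : ℝ → ℝ, IsSolution (X.indicator 1) (Y.indicator 1) S.L r r 1 0 u w)
    (hsol' : ∀ r : ℝ, ∃ u w : ℝ → ℝ, IsSolution (Y.indicator 1) (X.indicator 1) S.L r r 1 0 u w)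
    {a b : ℝ} (hab : (a = 1 ∧ b = 0) ∨ (a = 0 ∧ b = 1)) {f : ℂ → ℂ}
    (hf : ∀ z, ‖f z‖ ≤ neumannSum (X.indicator 1) (Y.indicator 1) ‖z‖ a b S.L)
    (hf' : ∀ r : ℝ, 0 ≤ r → ∃ z : ℂ, ‖z‖ = r ∧
      neumannSum (X.indicator 1) (Y.indicator 1) r a b S.L ≤ ‖f z‖) :
    growthOrder f = ((sInf (insert 1 S.coveringExponents) : ℝ) : EReal) := by
  have hL := S.L_pos.le
  have hXL : X ⊆ Ioo 0 S.L := by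
    rcases hXY with ⟨rfl, rfl⟩ | ⟨rfl, rfl⟩
    exacts [S.X₁_subset, S.X₂_subset]
  have hYL : Y ⊆ Ioo 0 S.L := by
    rcases hXY with ⟨rfl, rfl⟩ | ⟨rfl, rfl⟩
    exacts [S.X₂_subset, S.X₁_subset]
  have hbdd : BddBelow (insert 1 S.coveringExponents) := by
    refine ⟨0, ?_⟩
    rintro d (rfl | hd)
    exacts [zero_le_one, hd.1.le]
  have hsumXY (n : ℕ) (ω : Fin n → Set ℝ) :
      ∑ j, √(volume.real (ω j ∩ X) * volume.real (ω j ∩ Y))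
        = ∑ j, √(volume.real (ω j ∩ S.X₁) * volume.real (ω j ∩ S.X₂)) := by
    rcases hXY with ⟨rfl, rfl⟩ | ⟨rfl, rfl⟩
    · rfl
    · simp only [mul_comm]
  have hsol₀ (r : ℝ) : ∃ u w, IsSolution (X.indicator 1) (Y.indicator 1) S.L r r a b u w := by
    rcases hab with ⟨rfl, rfl⟩ | ⟨rfl, rfl⟩
    · exact hsol r
    · obtain ⟨u, w, h⟩ := hsol' r
      exact ⟨w, u, h.swap⟩
  have ha : 0 ≤ a := by rcases hab with ⟨rfl, rfl⟩ | ⟨rfl, rfl⟩ <;> norm_num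
  have hb : 0 ≤ b := by rcases hab with ⟨rfl, rfl⟩ | ⟨rfl, rfl⟩ <;> norm_num
  have hab1 : a + b = 1 := by rcases hab with ⟨rfl, rfl⟩ | ⟨rfl, rfl⟩ <;> norm_num
  apply le_antisymm
  · have upper {d C : ℝ} (hd : 0 ≤ d) (h : ∀ᶠ R : ℝ in atTop, ∃ (n : ℕ) (ω : Fin n → Set ℝ),
        (∀ j, (ω j).OrdConnected) ∧ Ioo 0 S.L ⊆ ⋃ j, ω j ∧
        ∑ j, √(volume.real (ω j ∩ X) * volume.real (ω j ∩ Y)) ≤ C * R ^ (d - 1) ∧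
        (n : ℝ) ≤ C * R ^ d) : growthOrder f ≤ d := by
      refine growthOrder_le_of_norm_le
        (C := C * (4 * √(2 * S.L + 1) + 7 + Real.log (S.L + 1))) ?_ hd
      have hnorm := tendsto_norm_cobounded_atTop (E := ℂ)
      filter_upwards [hnorm.eventually h, hnorm.eventually_ge_atTop 1]
        with z ⟨n, ω, h1, h2, h3, h4⟩ hz
      obtain ⟨u, w, hs⟩ := hsol₀ ‖z‖
      exact (hf z).trans
        (hs.neumannSum_le_exp_of_cover hX hY hXL hYL hL hz ha hb hab1 h1 h2 h3 h4)
    have all : ∀ d ∈ insert 1 S.coveringExponents, growthOrder f ≤ d := by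
      rintro d (rfl | ⟨hd, -, C, -, hC⟩)
      -- The exponent `1` is always available in the upper estimate: a single interval makes the sum
      -- in (A) constant in `R`.
      · refine upper (C := max 1 (√(volume.real X * volume.real Y))) zero_le_one ?_
        filter_upwards [eventually_ge_atTop 1] with R hR
        refine ⟨1, fun _ => univ, fun _ => ordConnected_univ,
          fun _ _ => mem_iUnion.2 ⟨0, trivial⟩, by simp, ?_⟩
        rw [Real.rpow_one, Nat.cast_one]
        exact one_le_mul_of_one_le_of_one_le (le_max_left _ _) hR
      · exact upper (C := C) hd.le (by simpa only [hsumXY] using hC)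
    refine EReal.le_of_forall_lt_iff_le.1 fun e he => ?_
    obtain ⟨d, hd, hde⟩ := exists_lt_of_csInf_lt (insert_nonempty _ _) (EReal.coe_lt_coe_iff.1 he)
    exact (all d hd).trans (by exact_mod_cast hde.le)
  · by_contra! hlt
    -- A `d` strictly between the order and the infimum lies in `(0, 1)`, because `1` was inserted.
    -- The greedy coverings make it admissible, a contradiction.
    obtain ⟨d, hd1, hd2⟩ := EReal.lt_iff_exists_real_btwn.1 hlt
    have hd0 : 0 < d := by exact_mod_cast (growthOrder_nonneg f).trans_lt hd1
    have hd2' : d < sInf (insert 1 S.coveringExponents) := by exact_mod_cast hd2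
    refine (csInf_le hbdd (mem_insert_of_mem _ ⟨hd0, hd2'.trans_le
      (csInf_le hbdd (mem_insert _ _)), ?_⟩)).not_gt hd2'
    have hcov := exists_cover_of_growth (d := d) hX hY hL hd0 hsol hsol' ?_
    · simpa only [hsumXY] using hcov
    have hev := norm_le_exp_of_growthOrder_lt hd1
    -- The bound now holds on entire circles of large radius, hence at the point where the Neumann
    -- sum is attained.
    rw [← comap_norm_atTop, eventually_comap] at hev
    filter_upwards [hev, eventually_ge_atTop 0] with r hr hr0
    obtain ⟨z, hz, hz'⟩ := hf' r hr0
    have hG := hz'.trans (hr z hz)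
    rw [hz] at hG
    refine neumannSum_diagonal_le hX hY hr0 hL ?_
    rcases hab with ⟨rfl, rfl⟩ | ⟨rfl, rfl⟩
    exacts [Or.inl hG, Or.inr hG]

end CanonicalSystem

end

/-- If the Hamiltonian takes a.e. only the values `diag(1, 0)` and `diag(0, 1)`, then the order of
the system, i.e. the order of each entry of the monodromy matrix `M(z) = M(L, z)`, is the infimum of
the admissible covering exponents. The infimum is taken in `[0, 1]`, so that it is `1` if no
exponent in `(0, 1)` is admissible. -/
theorem theorem2 (S : CanonicalSystem)
    (hS : ∀ᵐ x ∂MeasureTheory.volume.restrict (Set.Icc 0 S.L),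
      S.H x = CanonicalSystem.H₁ ∨ S.H x = CanonicalSystem.H₂)
    (M : ℝ → ℂ → Matrix (Fin 2) (Fin 2) ℂ) (hM : S.IsMonodromy M) (i j : Fin 2) :
    growthOrder (fun z => M S.L z i j) = ((sInf (insert 1 S.coveringExponents) : ℝ) : EReal) := by
  have h₁ := CanonicalSystem.isWeight_X₁ hS
  have h₂ := CanonicalSystem.isWeight_X₂ hS
  have c0 (z : ℂ) : IsSolution (S.X₂.indicator 1) (S.X₁.indicator 1) S.L z (-z) 1 0
      (fun x => M x z 0 0) (fun x => M x z 1 0) := by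
    simpa using CanonicalSystem.IsMonodromy.isSolution hS hM z 0
  -- For the second column, exchanging the components and replacing `z` by `-z` restores the same
  -- form with initial values `(1, 0)` and the weights exchanged.
  have c1 (z : ℂ) : IsSolution (S.X₁.indicator 1) (S.X₂.indicator 1) S.L z (-z) 1 0
      (fun x => M x (-z) 1 1) (fun x => M x (-z) 0 1) := by
    simpa using (CanonicalSystem.IsMonodromy.isSolution hS hM (-z) 1).swap
  obtain ⟨m1, m2, m3, m4⟩ := neumannSum_majorant S.L_pos.le h₂ h₁ c0
  obtain ⟨n1, n2, n3, n4⟩ := neumannSum_majorant S.L_pos.le h₁ h₂ c1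
  have s0 (r : ℝ) : ∃ u w, IsSolution (S.X₂.indicator 1) (S.X₁.indicator 1) S.L r r 1 0 u w :=
    ⟨_, _, (c0 _).real_of_imaginary h₂ h₁⟩
  have s1 (r : ℝ) : ∃ u w, IsSolution (S.X₁.indicator 1) (S.X₂.indicator 1) S.L r r 1 0 u w :=
    ⟨_, _, (c1 _).real_of_imaginary h₁ h₂⟩
  have hI {r : ℝ} (hr : 0 ≤ r) : ‖Complex.I * (r : ℂ)‖ = r := by simp [abs_of_nonneg hr]
  have hI' {r : ℝ} (hr : 0 ≤ r) : ‖-(Complex.I * (r : ℂ))‖ = r := by rw [norm_neg, hI hr]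
  fin_cases i <;> fin_cases j
  · exact S.growthOrder_eq_of_majorant (Or.inr ⟨rfl, rfl⟩) h₂ h₁ s0 s1 (Or.inl ⟨rfl, rfl⟩) m1
      fun r hr => ⟨_, hI hr, m3 r⟩
  · exact S.growthOrder_eq_of_majorant (Or.inr ⟨rfl, rfl⟩) h₂ h₁ s0 s1 (Or.inr ⟨rfl, rfl⟩)
      (fun z => by simpa using n2 (-z)) fun r hr => ⟨_, hI' hr, n4 r⟩
  · exact S.growthOrder_eq_of_majorant (Or.inl ⟨rfl, rfl⟩) h₁ h₂ s1 s0 (Or.inr ⟨rfl, rfl⟩) m2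
      fun r hr => ⟨_, hI hr, m4 r⟩
  · exact S.growthOrder_eq_of_majorant (Or.inl ⟨rfl, rfl⟩) h₁ h₂ s1 s0 (Or.inl ⟨rfl, rfl⟩)
      (fun z => by simpa using n1 (-z)) fun r hr => ⟨_, hI' hr, n3 r⟩
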